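/- Let $P_1,P_2,Q\ge 0$. Consider the Gaussian multiple-access channel $Y_i=X_{1,i}+X_{2,i}+S_i+Z_i$, $i=1,\dots,n$, where $S^n$ is i.i.d. $\mathcal N(0,Q)$, $Z^n$ is i.i.d. $\mathcal N(0,1)$, the messages $M_1$ and $M_2$ are uniformly distributed on finite sets, and $M_1,M_2,S^n,Z^n$ are mutually independent. Encoder 1 knows $M_1$ and the whole state sequence, $X_1^n=X_1^n(M_1,S^n)$; encoder 2 knows both messages but not the state, $X_2^n=X_2^n(M_1,M_2)$; the decoder forms $(\hat M_1,\hat M_2)$ from $Y^n$. The power constraints are $\sum_{i=1}^n\mathbb E[X_{k,i}^2]\le nP_k$, $k=1,2$. A pair $(R_1,R_2)$ of nonnegative rates is achievable if there are codes of every blocklength $n$ with $\lceil e^{nR_1}\rceil$ and $\lceil e^{nR_2}\rceil$ messages that satisfy the power constraints and for which $\Pr[(\hat M_1,\hat M_2)\ne(M_1,M_2)]\to0$ as $n\to\infty$. The capacity region $\mathcal C_{\mathrm{deg}}(P_1,P_2,Q)$ of this channel (the dirty MAC with degraded message sets) is the closure of the set of achievable pairs. Then for every $(R_1,R_2)\in\mathcal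 C_{\mathrm{deg}}(P_1,P_2,Q)$ there is a joint distribution $P_{X_1,X_2,S,U}$, with $X_1,X_2,S$ real-valued, $U$ taking values in some standard Borel space, and $S\sim\mathcal N(0,Q)$, such that - $X_1$ and $X_2$ are conditionally independent given $U$; - the pair $(U,X_2)$ is independent of $S$; - $\mathbb E[X_1^2]\le P_1$ and $\mathbb E[X_2^2]\le P_2$; and such that, with $Y=X_1+X_2+S+Z$, where $Z\sim\mathcal N(0,1)$ is independent of $(X_1,X_2,S,U)$, $$R_2\le I(X_2;Y\mid X_1,S,U),$$ $$R_2\le I(X_1;Y\mid X_2,S,U)+I(X_2;Y\mid U),$$ $$R_1+R_2\le I(X_1;Y\mid X_2,S,U)+I(X_2,U;Y),$$ where mutual information is measured in nats. -/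

import Mathlib

open MeasureTheory ProbabilityTheory Filter Topology
open scoped NNReal ENNReal

namespace DirtyMAC

/-! ### Mutual information (in nats), with values in `[0, ∞]` -/

section MutualInformation

variable {Ω α β γ : Type*} [MeasurableSpace Ω] [MeasurableSpace α] [MeasurableSpace β]
  [MeasurableSpace γ]

/-- Mutual information `I(A; B) = D(P_{A,B} ‖ P_A × P_B)`. -/
noncomputable def mutualInfo (μ : Measure Ω) (A : Ω → α) (B : Ω → β) : ℝ≥0∞ :=
  InformationTheory.klDiv (μ.map fun ω => (A ω, B ω)) ((μ.map A).prod (μ.map B))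

/-- Conditional mutual information
`I(A; B | C) = D(P_{C,A,B} ‖ P_C P_{A|C} P_{B|C})`, where `P_{A|C}`, `P_{B|C}` are regular
conditional distributions. -/
noncomputable def condMutualInfo [StandardBorelSpace α] [Nonempty α] [StandardBorelSpace β]
    [Nonempty β] (μ : Measure Ω) [IsFiniteMeasure μ] (A : Ω → α) (B : Ω → β) (C : Ω → γ) :
    ℝ≥0∞ :=
  InformationTheory.klDiv (μ.map fun ω => (C ω, (A ω, B ω)))
    ((μ.map C).compProd ((condDistrib A C μ).prod (condDistrib B C μ)))

end MutualInformation

/-! ### Codes for the channel `Y = X₁ + X₂ + S + Z` with degraded message sets -/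

/-- A block code of length `n` with `m₁ · m₂` messages. Encoder 1 knows the message `M₁` and
(noncausally) the whole state sequence; encoder 2 knows both messages but not the state; the
decoder only observes the channel output. -/
structure Code (n m₁ m₂ : ℕ) where
  /-- the state-cognitive encoder -/
  enc₁ : Fin m₁ → (Fin n → ℝ) → (Fin n → ℝ)
  measurable_enc₁ : ∀ a, Measurable (enc₁ a)
  /-- the non-cognitive encoder -/
  enc₂ : Fin m₁ → Fin m₂ → (Fin n → ℝ)
  /-- the decoder -/
  dec : (Fin n → ℝ) → Fin m₁ × Fin m₂
  measurable_dec : Measurable dec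

/-- Outcomes `((M₁, M₂), (Sⁿ, Zⁿ))` of a transmission. -/
abbrev Outcome (n m₁ m₂ : ℕ) : Type :=
  (Fin m₁ × Fin m₂) × ((Fin n → ℝ) × (Fin n → ℝ))

/-- The law of `((M₁, M₂), (Sⁿ, Zⁿ))`: all components are independent, the messages are uniform,
`Sⁿ` is i.i.d. `N(0, Q)`, and `Zⁿ` is i.i.d. `N(0, 1)`. -/
noncomputable def outcomeLaw (n m₁ m₂ : ℕ) (Q : ℝ≥0) : Measure (Outcome n m₁ m₂) :=
  ((uniformOn (Set.univ : Set (Fin m₁))).prod (uniformOn (Set.univ : Set (Fin m₂)))).prod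
    ((Measure.pi fun _ : Fin n => gaussianReal 0 Q).prod
      (Measure.pi fun _ : Fin n => gaussianReal 0 1))

namespace Code

variable {n m₁ m₂ : ℕ}

/-- The input sequence of user 1. -/
def input₁ (c : Code n m₁ m₂) (ω : Outcome n m₁ m₂) : Fin n → ℝ := c.enc₁ ω.1.1 ω.2.1

/-- The input sequence of user 2. -/
def input₂ (c : Code n m₁ m₂) (ω : Outcome n m₁ m₂) : Fin n → ℝ := c.enc₂ ω.1.1 ω.1.2

/-- The channel output sequence `Yⁿ = X₁ⁿ + X₂ⁿ + Sⁿ + Zⁿ`. -/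
def output (c : Code n m₁ m₂) (ω : Outcome n m₁ m₂) : Fin n → ℝ :=
  fun i => c.input₁ ω i + c.input₂ ω i + ω.2.1 i + ω.2.2 i

/-- The average power constraints `∑ᵢ E[X_{k,i}²] ≤ n P_k`, `k = 1, 2`. -/
def SatisfiesPower (c : Code n m₁ m₂) (P₁ P₂ Q : ℝ≥0) : Prop :=
  (∑ i, ∫⁻ ω, ENNReal.ofReal (c.input₁ ω i ^ 2) ∂(outcomeLaw n m₁ m₂ Q) ≤ n * (P₁ : ℝ≥0∞)) ∧
  (∑ i, ∫⁻ ω, ENNReal.ofReal (c.input₂ ω i ^ 2) ∂(outcomeLaw n m₁ m₂ Q) ≤ n * (P₂ : ℝ≥0∞))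

/-- The average probability of error `P[(M̂₁, M̂₂) ≠ (M₁, M₂)]`. -/
noncomputable def errorProb (c : Code n m₁ m₂) (Q : ℝ≥0) : ℝ≥0∞ :=
  outcomeLaw n m₁ m₂ Q {ω | c.dec (c.output ω) ≠ ω.1}

end Code

/-- `(R₁, R₂)` (in nats per channel use) is achievable: there are codes of every length `n` with
`⌈exp (n R₁)⌉` and `⌈exp (n R₂)⌉` messages that satisfy the power constraints and whose
probability of error tends to `0`. -/
def Achievable (P₁ P₂ Q : ℝ≥0) (R₁ R₂ : ℝ) : Prop :=
  0 ≤ R₁ ∧ 0 ≤ R₂ ∧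
    ∃ c : ∀ n : ℕ, Code n ⌈Real.exp (n * R₁)⌉₊ ⌈Real.exp (n * R₂)⌉₊,
      (∀ n, (c n).SatisfiesPower P₁ P₂ Q) ∧ Tendsto (fun n => (c n).errorProb Q) atTop (𝓝 0)

/-- The capacity region of the dirty MAC with degraded message sets: the closure of the set of
achievable rate pairs. -/
def capacityRegionDeg (P₁ P₂ Q : ℝ≥0) : Set (ℝ × ℝ) :=
  closure {R | Achievable P₁ P₂ Q R.1 R.2}

/-! ### The single-letter region -/

section SingleLetter

variable {𝒰 : Type} [MeasurableSpace 𝒰]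

/-- The conditions on the joint law `P` of `(X₁, X₂, S, U)`. -/
structure Admissible [StandardBorelSpace 𝒰] (P₁ P₂ Q : ℝ≥0) (P : Measure (ℝ × ℝ × ℝ × 𝒰))
    [IsProbabilityMeasure P] : Prop where
  /-- `S ∼ N(0, Q)` -/
  state : P.map (fun x => x.2.2.1) = gaussianReal 0 Q
  /-- `X₁` and `X₂` are conditionally independent given `U` -/
  condIndep : CondIndepFun
    (MeasurableSpace.comap (fun x : ℝ × ℝ × ℝ × 𝒰 => x.2.2.2) inferInstance)
    (Measurable.comap_le (by fun_prop)) (fun x => x.1) (fun x => x.2.1) P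
  /-- `(U, X₂)` is independent of `S` -/
  indep : IndepFun (fun x => (x.2.2.2, x.2.1)) (fun x => x.2.2.1) P
  power₁ : ∫⁻ x, ENNReal.ofReal (x.1 ^ 2) ∂P ≤ P₁
  power₂ : ∫⁻ x, ENNReal.ofReal (x.2.1 ^ 2) ∂P ≤ P₂

/- Random variables on the space of outcomes `((X₁, X₂, S, U), Z)` of a single channel use. -/

/-- input of user 1 -/
def X₁ (ω : (ℝ × ℝ × ℝ × 𝒰) × ℝ) : ℝ := ω.1.1
/-- input of user 2 -/
def X₂ (ω : (ℝ × ℝ × ℝ × 𝒰) × ℝ) : ℝ := ω.1.2.1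
/-- state -/
def S (ω : (ℝ × ℝ × ℝ × 𝒰) × ℝ) : ℝ := ω.1.2.2.1
/-- auxiliary variable -/
def U (ω : (ℝ × ℝ × ℝ × 𝒰) × ℝ) : 𝒰 := ω.1.2.2.2
/-- noise -/
def Z (ω : (ℝ × ℝ × ℝ × 𝒰) × ℝ) : ℝ := ω.2
/-- channel output -/
def Y (ω : (ℝ × ℝ × ℝ × 𝒰) × ℝ) : ℝ := X₁ ω + X₂ ω + S ω + Z ω

/-- The joint law of `((X₁, X₂, S, U), Z)`, where `Z ∼ N(0, 1)` is independent of
`(X₁, X₂, S, U) ∼ P`. -/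
noncomputable abbrev withNoise (P : Measure (ℝ × ℝ × ℝ × 𝒰)) : Measure ((ℝ × ℝ × ℝ × 𝒰) × ℝ) :=
  P.prod (gaussianReal 0 1)

/-- The three rate constraints for the joint law `P` of `(X₁, X₂, S, U)`. As the mutual
informations are nonnegative, `ENNReal.ofReal R ≤ I` is the same as `R ≤ I`, also for `R < 0`. -/
def RateConstraints (P : Measure (ℝ × ℝ × ℝ × 𝒰)) [IsProbabilityMeasure P] (R₁ R₂ : ℝ) : Prop :=
  ENNReal.ofReal R₂ ≤ condMutualInfo (withNoise P) X₂ Y (fun ω => (X₁ ω, S ω, U ω)) ∧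
  ENNReal.ofReal R₂ ≤
    condMutualInfo (withNoise P) X₁ Y (fun ω => (X₂ ω, S ω, U ω)) +
      condMutualInfo (withNoise P) X₂ Y U ∧
  ENNReal.ofReal (R₁ + R₂) ≤
    condMutualInfo (withNoise P) X₁ Y (fun ω => (X₂ ω, S ω, U ω)) +
      mutualInfo (withNoise P) (fun ω => (X₂ ω, U ω)) Y

end SingleLetter

/-- The set of rate pairs that satisfy the three constraints for some admissible joint law of
`(X₁, X₂, S, U)`, where `U` takes values in some standard Borel space. -/
def outerRegionDeg (P₁ P₂ Q : ℝ≥0) : Set (ℝ × ℝ) :=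
  {R | ∃ (𝒰 : Type) (_ : MeasurableSpace 𝒰) (_ : StandardBorelSpace 𝒰)
      (P : Measure (ℝ × ℝ × ℝ × 𝒰)) (_ : IsProbabilityMeasure P),
      Admissible P₁ P₂ Q P ∧ RateConstraints P R.1 R.2}

end DirtyMAC

/-! The inclusion passes through an explicit intermediate set, `gaussianRegion`: the rates obtained
from jointly Gaussian inputs. Every achievable pair lies in it (`Achievable.mem_gaussianRegion`), it
is closed (`isClosed_gaussianRegion`), and Gaussian inputs with a real `U` place it inside the outer
region (`gaussianRegion_subset_outerRegionDeg`). For the last step only lower bounds on mutual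
informations are needed.

For the converse, fix a code and split each input into its conditional mean given `M₁` and the
deviation from it. Averaged over the block, the deviations have second moments `A` and `B`, the
deviation of user 1 has covariance `C` with the state, and the means have second moments `α`, `β`
and correlation `ρ`. The Gaussian inputs to match are `a = √α`, `b = √β`, `v = √B`, `k = C/√Q` (the
part of user 1's deviation along the state) and `w = √(A - C²/Q)` (the rest).

Each rate bound is Fano's inequality as a change of measure (`measureReal_mul_log_sub_log_two_le`).
Under a Gaussian reference law the output does not depend on the message to be decoded, so decoding
succeeds with probability at most `1/M`. Then `P(E) log M - log 2` is at most the mean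
log-likelihood ratio of the true law to the reference. That ratio is quadratic, so its mean depends
on the code only through the moments above. One reference variance serves the whole block, so
neither time sharing nor concavity is needed.

For the second and third bounds the law of `Y` given the messages is unknown, because `X₁` depends
on `S` arbitrarily. The reference is therefore a joint law of `(S, Y)` in backward form
(`HasMoments.exists_reference`): `Y` is Gaussian, and given `Y` the state is Gaussian around its
linear estimate. Integrating out the state leaves a Gaussian output, and the estimation error `Q(1 +
w²)/T`, with `T` the effective noise, produces the terms `log(1 + w²)/2 - (log T)/2`. -/

namespace DirtyMAC

/-! ### Divergence and mutual information of additive Gaussian channels -/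

section GaussianKernel

variable {Ω α γ : Type*} [MeasurableSpace Ω] [MeasurableSpace α] [MeasurableSpace γ]

/-- The additive Gaussian noise kernel `c ↦ N(m c, v)`. -/
noncomputable def gaussianKernel (m : γ → ℝ) (hm : Measurable m) (v : ℝ≥0) : Kernel γ ℝ where
  toFun c := gaussianReal (m c) v
  measurable' := measurable_gaussianReal.comp (hm.prodMk measurable_const)

instance (m : γ → ℝ) (hm : Measurable m) (v : ℝ≥0) : IsMarkovKernel (gaussianKernel m hm v) :=
  ⟨fun c => inferInstanceAs (IsProbabilityMeasure (gaussianReal (m c) v))⟩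

lemma gaussianKernel_apply (m : γ → ℝ) (hm : Measurable m) (v : ℝ≥0) (c : γ) :
    gaussianKernel m hm v c = gaussianReal (m c) v := rfl

lemma map_prodMk_add_eq_compProd {μ : Measure Ω} [IsProbabilityMeasure μ] {C : Ω → γ}
    (hC : Measurable C) {m : γ → ℝ} (hm : Measurable m) {N : Ω → ℝ} (hN : Measurable N)
    {v : ℝ≥0} (hCN : IndepFun C N μ) (hlaw : μ.map N = gaussianReal 0 v) :
    μ.map (fun ω => (C ω, m (C ω) + N ω)) = μ.map C ⊗ₘ gaussianKernel m hm v := by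
  refine Measure.ext_of_lintegral _ fun f hf => ?_
  have : IsProbabilityMeasure (μ.map C) := Measure.isProbabilityMeasure_map hC.aemeasurable
  have hg : Measurable fun p : γ × ℝ => f (p.1, m p.1 + p.2) := by fun_prop
  rw [lintegral_map hf (by fun_prop), Measure.lintegral_compProd hf]
  have h := (indepFun_iff_map_prod_eq_prod_map_map hC.aemeasurable hN.aemeasurable).1 hCN
  rw [← lintegral_map (f := fun p : γ × ℝ => f (p.1, m p.1 + p.2)) hg (hC.prodMk hN), h, hlaw,
    lintegral_prod _ hg.aemeasurable]
  refine lintegral_congr fun c => ?_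
  rw [gaussianKernel_apply, ← zero_add (m c), ← gaussianReal_map_const_add,
    lintegral_map (by fun_prop) (by fun_prop)]

lemma gaussianPDFReal_eq_exp (m : ℝ) {v : ℝ≥0} (hv : v ≠ 0) (x : ℝ) :
    gaussianPDFReal m v x
      = Real.exp (-(Real.log (2 * Real.pi) / 2) - Real.log v / 2 - (x - m) ^ 2 / (2 * v)) := by
  have hv' : (0 : ℝ) < v := by positivity
  have h2 : (0 : ℝ) < 2 * Real.pi := by positivity
  have h : Real.sqrt (2 * Real.pi * v)
      = Real.exp (Real.log (2 * Real.pi) / 2 + Real.log v / 2) := by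
    rw [← add_div, ← Real.log_mul h2.ne' hv'.ne', Real.sqrt_eq_rpow,
      Real.rpow_def_of_pos (by positivity)]
    congr 1; ring
  rw [gaussianPDFReal, h, ← Real.exp_neg, ← Real.exp_add]
  congr 1; ring

lemma integral_sq_of_map_eq_gaussianReal {μ : Measure Ω} {N : Ω → ℝ} (hN : Measurable N)
    {v : ℝ≥0} (hlaw : μ.map N = gaussianReal 0 v) : ∫ ω, N ω ^ 2 ∂μ = v := by
  have h := variance_fun_id_gaussianReal (μ := 0) (v := v)
  rw [variance_eq_integral measurable_id'.aemeasurable] at h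
  simp only [integral_id_gaussianReal, sub_zero] at h
  rw [← h, ← hlaw, integral_map hN.aemeasurable (by fun_prop)]

lemma memLp_two_of_map_eq_gaussianReal {μ : Measure Ω} {N : Ω → ℝ} (hN : Measurable N)
    {v : ℝ≥0} (hlaw : μ.map N = gaussianReal 0 v) : MemLp N 2 μ := by
  have h := memLp_id_gaussianReal' (μ := 0) (v := v) 2 (by simp)
  rw [← hlaw] at h
  exact (memLp_map_measure_iff (by fun_prop) hN.aemeasurable).1 h

/-- A lower bound on the divergence between two additive Gaussian channels with a common input
`D`, when the output is `m D + N = m' D + N'`. -/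
lemma le_klDiv_gaussianKernel {μ : Measure Ω} [IsProbabilityMeasure μ] {D : Ω → γ}
    (hD : Measurable D) {B N N' : Ω → ℝ} (hN : Measurable N) (hN' : Measurable N')
    {m m' : γ → ℝ} (hm : Measurable m) (hm' : Measurable m') {v v' : ℝ≥0} (hv : v ≠ 0)
    (hv' : v' ≠ 0) (hB : ∀ ω, B ω = m (D ω) + N ω) (hB' : ∀ ω, B ω = m' (D ω) + N' ω)
    (hDN : IndepFun D N μ) (hlaw : μ.map N = gaussianReal 0 v)
    (hlaw' : μ.map N' = gaussianReal 0 v') :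
    ENNReal.ofReal (Real.log (v' / v) / 2) ≤
      InformationTheory.klDiv (μ.map fun ω => (D ω, B ω))
        (μ.map D ⊗ₘ gaussianKernel m' hm' v') := by
  obtain rfl : B = fun ω => m (D ω) + N ω := funext hB
  set J := μ.map fun ω => (D ω, m (D ω) + N ω) with hJ
  set R := μ.map D ⊗ₘ gaussianKernel m' hm' v' with hR
  have : IsProbabilityMeasure (μ.map D) := Measure.isProbabilityMeasure_map hD.aemeasurable
  have : IsProbabilityMeasure J := Measure.isProbabilityMeasure_map (by fun_prop)
  -- The log-likelihood ratio of `N(m, v)` to `N(m', v')`. Along `B` its two squares are `N'²` and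
  -- `N²`, whose means `v'` and `v` make the quadratic terms cancel; `N'` need not be independent of
  -- `D`.
  let l : γ × ℝ → ℝ := fun p =>
    Real.log (v' / v) / 2 + (p.2 - m' p.1) ^ 2 / (2 * v') - (p.2 - m p.1) ^ 2 / (2 * v)
  have hl : Measurable l := by fun_prop
  have hvpos : (0 : ℝ) < v := by positivity
  have hvpos' : (0 : ℝ) < v' := by positivity
  have hJR : J = R.withDensity fun p => ENNReal.ofReal (Real.exp (l p)) := by
    refine Measure.ext_of_lintegral _ fun f hf => ?_
    rw [hJ, map_prodMk_add_eq_compProd hD hm hN hDN hlaw,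
      lintegral_withDensity_eq_lintegral_mul _ (by fun_prop) hf, Measure.lintegral_compProd hf,
      Measure.lintegral_compProd (by fun_prop)]
    refine lintegral_congr fun c => ?_
    rw [gaussianKernel_apply, gaussianKernel_apply, gaussianReal_of_var_ne_zero _ hv,
      gaussianReal_of_var_ne_zero _ hv', lintegral_withDensity_eq_lintegral_mul _ (by fun_prop)
        (by fun_prop), lintegral_withDensity_eq_lintegral_mul _ (by fun_prop) (by fun_prop)]
    refine lintegral_congr fun b => ?_
    simp only [Pi.mul_apply, gaussianPDF]
    rw [← mul_assoc, ← ENNReal.ofReal_mul (gaussianPDFReal_nonneg _ _ _),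
      gaussianPDFReal_eq_exp _ hv, gaussianPDFReal_eq_exp _ hv', ← Real.exp_add]
    congr 3
    simp only [l]
    rw [Real.log_div hvpos'.ne' hvpos.ne']
    ring
  have hac : J ≪ R := hJR ▸ withDensity_absolutelyContinuous _ _
  have hllr : llr J R =ᵐ[J] l := by
    refine hac.ae_le ?_
    filter_upwards [Measure.rnDeriv_withDensity R
      (f := fun p => ENNReal.ofReal (Real.exp (l p))) (by fun_prop)] with p hp
    rw [llr, hJR, hp, ENNReal.toReal_ofReal (Real.exp_pos _).le, Real.log_exp]
  -- Without integrability the divergence is `⊤` and the bound is trivial.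
  by_cases hint : Integrable (llr J R) J
  swap
  · rw [InformationTheory.klDiv_of_not_integrable hint]; exact le_top
  rw [InformationTheory.klDiv_of_ac_of_integrable hac hint, integral_congr_ae hllr]
  refine ENNReal.ofReal_le_ofReal (le_of_eq ?_)
  simp only [probReal_univ, add_sub_cancel_right]
  rw [hJ, integral_map (by fun_prop) (by fun_prop)]
  have hl' : ∀ ω, l (D ω, m (D ω) + N ω)
      = Real.log (v' / v) / 2 + N' ω ^ 2 / (2 * v') - N ω ^ 2 / (2 * v) := by
    intro ω
    simp only [l]
    rw [add_sub_cancel_left, show m (D ω) + N ω = m' (D ω) + N' ω from hB' ω, add_sub_cancel_left]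
  simp_rw [hl']
  have i1 := (memLp_two_of_map_eq_gaussianReal hN hlaw).integrable_sq
  have i2 := (memLp_two_of_map_eq_gaussianReal hN' hlaw').integrable_sq
  have i3 : Integrable (fun ω => Real.log (v' / v) / 2 + N' ω ^ 2 / (2 * v')) μ :=
    (integrable_const _).add (i2.div_const _)
  rw [integral_sub i3 (i1.div_const _),
    integral_add (integrable_const _) (i2.div_const _), integral_div (r := 2 * (v : ℝ)), integral_div (r := 2 * (v' : ℝ)),
    integral_sq_of_map_eq_gaussianReal hN hlaw, integral_sq_of_map_eq_gaussianReal hN' hlaw']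
  simp only [integral_const, probReal_univ, smul_eq_mul, one_mul]
  field_simp
  ring

lemma le_mutualInfo_of_gaussian {μ : Measure Ω} [IsProbabilityMeasure μ] {A : Ω → α}
    (hA : Measurable A) {B N : Ω → ℝ} (hN : Measurable N) {m : α → ℝ} (hm : Measurable m)
    {v v' : ℝ≥0} (hv : v ≠ 0) (hv' : v' ≠ 0) (hB : ∀ ω, B ω = m (A ω) + N ω)
    (hAN : IndepFun A N μ) (hlaw : μ.map N = gaussianReal 0 v)
    (hlaw' : μ.map B = gaussianReal 0 v') :
    ENNReal.ofReal (Real.log (v' / v) / 2) ≤ mutualInfo μ A B := by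
  have hBm : Measurable B := by
    rw [funext hB]; fun_prop
  have h := le_klDiv_gaussianKernel hA hN hBm hm (m' := fun _ => 0) measurable_const hv hv' hB
    (by simp) hAN hlaw hlaw'
  have hk : gaussianKernel (fun _ : α => (0 : ℝ)) measurable_const v'
      = Kernel.const α (gaussianReal 0 v') := by
    ext; simp [gaussianKernel_apply]
  rwa [hk, Measure.compProd_const, ← hlaw'] at h

/-- Given `C`, the output is `N(m' C, v')`. Up to reassociation, `P_C P_{A|C} P_{B|C}` is thus the
law of `(C, A)` followed by a Gaussian kernel that ignores `A`, and `le_klDiv_gaussianKernel`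
applies with input `(C, A)`. -/
lemma le_condMutualInfo_of_gaussian [StandardBorelSpace α] [Nonempty α] {μ : Measure Ω}
    [IsProbabilityMeasure μ] {A : Ω → α} (hA : Measurable A) {C : Ω → γ} (hC : Measurable C)
    {B N N' : Ω → ℝ} (hN : Measurable N) (hN' : Measurable N') {m : γ × α → ℝ}
    (hm : Measurable m) {m' : γ → ℝ} (hm' : Measurable m') {v v' : ℝ≥0} (hv : v ≠ 0)
    (hv' : v' ≠ 0) (hB : ∀ ω, B ω = m (C ω, A ω) + N ω) (hB' : ∀ ω, B ω = m' (C ω) + N' ω)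
    (hN_indep : IndepFun (fun ω => (C ω, A ω)) N μ) (hN'_indep : IndepFun C N' μ)
    (hlaw : μ.map N = gaussianReal 0 v) (hlaw' : μ.map N' = gaussianReal 0 v') :
    ENNReal.ofReal (Real.log (v' / v) / 2) ≤ condMutualInfo μ A B C := by
  have hBm : Measurable B := by
    rw [funext hB]; fun_prop
  have h := le_klDiv_gaussianKernel (hC.prodMk hA) hN hN' hm (m' := fun p => m' p.1)
    (by fun_prop) hv hv' hB hB' hN_indep hlaw hlaw'
  refine h.trans ?_
  have : IsProbabilityMeasure (μ.map C) := Measure.isProbabilityMeasure_map hC.aemeasurable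
  have hcd : condDistrib B C μ =ᵐ[μ.map C] gaussianKernel m' hm' v' := by
    refine condDistrib_ae_eq_of_measure_eq_compProd C hBm.aemeasurable ?_
    rw [← map_prodMk_add_eq_compProd hC hm' hN' hN'_indep hlaw', funext hB']
  have hker : (condDistrib A C μ ×ₖ condDistrib B C μ) =ᵐ[μ.map C]
      (condDistrib A C μ ×ₖ gaussianKernel m' hm' v') := by
    filter_upwards [hcd] with c hc
    rw [Kernel.prod_apply, Kernel.prod_apply, hc]
  have hR : (μ.map C) ⊗ₘ (condDistrib A C μ ×ₖ condDistrib B C μ)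
      = (μ.map (fun ω => (C ω, A ω)) ⊗ₘ gaussianKernel (fun p => m' p.1) (by fun_prop) v').map
          MeasurableEquiv.prodAssoc := by
    rw [Measure.compProd_congr hker]
    refine Measure.ext_of_lintegral _ fun f hf => ?_
    rw [Measure.lintegral_compProd hf, lintegral_map hf (by fun_prop),
      Measure.lintegral_compProd (by fun_prop), ← compProd_map_condDistrib hA.aemeasurable,
      Measure.lintegral_compProd (f := fun p : γ × α => _) ?_]
    · refine lintegral_congr fun c => ?_
      rw [Kernel.prod_apply, lintegral_prod _ (by fun_prop)]
      rfl
    · exact Measurable.lintegral_kernel_prod_right' (f := fun p : (γ × α) × ℝ =>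
        f (MeasurableEquiv.prodAssoc p)) (by fun_prop)
  have hJ : (μ.map fun ω => (C ω, (A ω, B ω)))
      = (μ.map fun ω => ((C ω, A ω), B ω)).map MeasurableEquiv.prodAssoc := by
    rw [Measure.map_map (by fun_prop) (by fun_prop)]
    rfl
  unfold condMutualInfo
  rw [hR, hJ]
  set J' := (μ.map fun ω => ((C ω, A ω), B ω))
  set R' := (μ.map (fun ω => (C ω, A ω)) ⊗ₘ
    gaussianKernel (fun p : γ × α => m' p.1) (by fun_prop) v')
  have hinv : ∀ ν : Measure ((γ × α) × ℝ),
      (ν.map MeasurableEquiv.prodAssoc).map MeasurableEquiv.prodAssoc.symm = ν := by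
    intro ν
    simp
  have : IsProbabilityMeasure J' := Measure.isProbabilityMeasure_map (by fun_prop)
  have : IsProbabilityMeasure (μ.map (fun ω => (C ω, A ω))) :=
    Measure.isProbabilityMeasure_map (by fun_prop)
  -- Data processing along the inverse of the reassociation gives the one direction needed.
  calc InformationTheory.klDiv J' R'
      = InformationTheory.klDiv ((J'.map MeasurableEquiv.prodAssoc).map
          MeasurableEquiv.prodAssoc.symm) ((R'.map MeasurableEquiv.prodAssoc).map
          MeasurableEquiv.prodAssoc.symm) := by rw [hinv, hinv]
    _ ≤ _ := InformationTheory.klDiv_map_le _ _ (by fun_prop)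

end GaussianKernel

/-! ### Linear images and independence for standard Gaussian vectors -/

section StandardGaussian

variable {ι : Type*} [Fintype ι]

/-- The law of i.i.d. standard Gaussian variables. -/
noncomputable abbrev stdNormal (ι : Type*) [Fintype ι] : Measure (ι → ℝ) :=
  Measure.pi fun _ => gaussianReal 0 1

lemma stdNormal_map_sum (c : ι → ℝ) :
    (stdNormal ι).map (fun x => ∑ i, c i * x i)
      = gaussianReal 0 (Real.toNNReal (∑ i, c i ^ 2)) := by
  classical
  have hind : iIndepFun (fun i (x : ι → ℝ) => c i * x i) (stdNormal ι) :=
    iIndepFun_pi (X := fun i (y : ℝ) => c i * y) (fun i => by fun_prop)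
  suffices h : ∀ s : Finset ι, (stdNormal ι).map (∑ i ∈ s, fun x : ι → ℝ => c i * x i)
      = gaussianReal 0 (Real.toNNReal (∑ i ∈ s, c i ^ 2)) by
    rw [← h Finset.univ]
    congr 1
    ext x; simp
  intro s
  induction s using Finset.induction_on with
  | empty =>
    have : (0 : (ι → ℝ) → ℝ) = fun _ => 0 := rfl
    simp [this, Measure.map_const]
  | insert i s hi ih =>
    rw [Finset.sum_insert hi, Finset.sum_insert hi, Real.toNNReal_add (sq_nonneg _)
      (Finset.sum_nonneg fun _ _ => sq_nonneg _), ← zero_add (0 : ℝ)]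
    refine gaussianReal_add_gaussianReal_of_indepFun ?_ ?_ ih
    · exact (hind.indepFun_finsetSum_of_notMem (fun i => by fun_prop) hi).symm
    · have : (fun x : ι → ℝ => c i * x i) = (fun y => c i * y) ∘ fun x => x i := rfl
      rw [this, ← Measure.map_map (by fun_prop) (by fun_prop),
        (measurePreserving_eval (fun _ : ι => gaussianReal 0 1) i).map_eq,
        gaussianReal_map_const_mul, mul_zero, mul_one]
      congr 1
      ext
      simp [sq_nonneg]

/-- That `f` depends only on the coordinates in `s`, and `g` only on the others, is expressed by
zeroing the remaining coordinates; for explicit linear maps this is a computation. -/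
lemma indepFun_stdNormal {β β' : Type*} [MeasurableSpace β] [MeasurableSpace β'] [DecidableEq ι]
    (s : Finset ι) {f : (ι → ℝ) → β} {g : (ι → ℝ) → β'} (hf : Measurable f) (hg : Measurable g)
    (hfs : ∀ x, f x = f fun i => if i ∈ s then x i else 0)
    (hgs : ∀ x, g x = g fun i => if i ∈ s then 0 else x i) : IndepFun f g (stdNormal ι) := by
  have hind : iIndepFun (fun i (x : ι → ℝ) => x i) (stdNormal ι) :=
    iIndepFun_pi (X := fun i (y : ℝ) => y) (fun i => by fun_prop)
  have h := hind.indepFun_finset s sᶜ disjoint_compl_right (fun i => by fun_prop)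
  have hφ : Measurable fun y : s → ℝ => f fun i => if h : i ∈ s then y ⟨i, h⟩ else 0 := by
    refine hf.comp (measurable_pi_lambda _ fun i => ?_)
    by_cases h : i ∈ s
    · simp only [h, dite_true]; fun_prop
    · simp only [h, dite_false]; fun_prop
  have hψ : Measurable fun y : ↥(sᶜ) → ℝ =>
      g fun i => if h : i ∈ sᶜ then y ⟨i, h⟩ else 0 := by
    refine hg.comp (measurable_pi_lambda _ fun i => ?_)
    by_cases h : i ∈ sᶜ
    · simp only [h, dite_true]; fun_prop
    · simp only [h, dite_false]; fun_prop
  convert h.comp hφ hψ using 1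
  · ext1 x
    rw [hfs]; simp
  · ext1 x
    rw [hgs]
    simp only [Function.comp_def]
    congr 1
    ext i
    by_cases h : i ∈ s <;> simp [h]

end StandardGaussian

section Transfer

variable {Ω Ω' β β' : Type*} [MeasurableSpace Ω] [MeasurableSpace Ω'] [MeasurableSpace β]
  [MeasurableSpace β']

lemma indepFun_map {μ : Measure Ω} [IsProbabilityMeasure μ] {F : Ω → Ω'} (hF : Measurable F)
    {f : Ω' → β} {g : Ω' → β'} (hf : Measurable f) (hg : Measurable g)
    (h : IndepFun (fun ω => f (F ω)) (fun ω => g (F ω)) μ) : IndepFun f g (μ.map F) := by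
  have : IsProbabilityMeasure (μ.map F) := Measure.isProbabilityMeasure_map hF.aemeasurable
  rw [indepFun_iff_map_prod_eq_prod_map_map (by fun_prop) (by fun_prop)] at h ⊢
  rw [Measure.map_map (by fun_prop) hF, Measure.map_map hf hF, Measure.map_map hg hF]
  exact h

/-- `X = m(K) + G` with `G` Gaussian and independent of `(K, W)` is conditionally independent of
`W` given `K`. -/
lemma condIndepFun_of_add_gaussian [StandardBorelSpace Ω] {μ : Measure Ω} [IsProbabilityMeasure μ]
    {K : Ω → β} (hK : Measurable K) {W : Ω → ℝ} (hW : Measurable W) {X G : Ω → ℝ}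
    (hG : Measurable G) {m : β → ℝ} (hm : Measurable m) (hX : ∀ ω, X ω = m (K ω) + G ω)
    {v : ℝ≥0} (hind : IndepFun (fun ω => (K ω, W ω)) G μ) (hlaw : μ.map G = gaussianReal 0 v) :
    CondIndepFun (MeasurableSpace.comap K inferInstance) hK.comap_le X W μ := by
  have hXm : Measurable X := by rw [funext hX]; fun_prop
  refine CondIndepFun.symm ?_
  -- It suffices that the conditional law of `X` given `(K, W)` ignores `W`: with or without `W` it
  -- is `N(m K, v)`.
  rw [condIndepFun_iff_condDistrib_prod_ae_eq_prodMkRight hXm hW hK]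
  have h1 : condDistrib X (fun ω => (K ω, W ω)) μ =ᵐ[μ.map fun ω => (K ω, W ω)]
      gaussianKernel (fun p => m p.1) (by fun_prop) v := by
    refine condDistrib_ae_eq_of_measure_eq_compProd _ hXm.aemeasurable ?_
    rw [← map_prodMk_add_eq_compProd (hK.prodMk hW) (m := fun p : β × ℝ => m p.1) (by fun_prop)
      hG hind hlaw, funext hX]
  have h2 : condDistrib X K μ =ᵐ[μ.map K] gaussianKernel m hm v := by
    refine condDistrib_ae_eq_of_measure_eq_compProd _ hXm.aemeasurable ?_
    rw [← map_prodMk_add_eq_compProd hK hm hG (hind.comp measurable_fst measurable_id) hlaw,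
      funext hX]
  have h3 : μ.map K = (μ.map fun ω => (K ω, W ω)).map Prod.fst := by
    rw [Measure.map_map (by fun_prop) (by fun_prop)]; rfl
  rw [h3] at h2
  filter_upwards [h1, ae_of_ae_map (by fun_prop) h2] with p hp hp'
  rw [hp, Kernel.prodMkRight_apply, hp']
  rfl

end Transfer

/-! ### The Gaussian region and the Gaussian inputs that realise it -/

/-- The variance of the interference plus noise `X₁ + S + Z` given `U` in the Gaussian scheme. -/
noncomputable def effNoise (Q : ℝ≥0) (k w : ℝ) : ℝ := (k + √(Q : ℝ)) ^ 2 + w ^ 2 + 1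

lemma one_le_effNoise (Q : ℝ≥0) (k w : ℝ) : 1 ≤ effNoise Q k w := by
  unfold effNoise; nlinarith [sq_nonneg (k + √(Q : ℝ)), sq_nonneg w]

/-- The rate pairs that satisfy the three constraints for jointly Gaussian inputs
`X₁ = a U + k S₀ + w W`, `X₂ = b U + v V`, where `S = √Q S₀`. -/
def gaussianRegion (P₁ P₂ Q : ℝ≥0) : Set (ℝ × ℝ) :=
  {R | ∃ a k w b v : ℝ, a ^ 2 + k ^ 2 + w ^ 2 ≤ P₁ ∧ b ^ 2 + v ^ 2 ≤ P₂ ∧ (Q = 0 → k = 0) ∧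
    R.2 ≤ Real.log (1 + v ^ 2) / 2 ∧
    R.2 ≤ Real.log (1 + w ^ 2) / 2 +
      Real.log ((effNoise Q k w + v ^ 2) / effNoise Q k w) / 2 ∧
    R.1 + R.2 ≤ Real.log (1 + w ^ 2) / 2 +
      Real.log ((effNoise Q k w + v ^ 2 + (a + b) ^ 2) / effNoise Q k w) / 2}

section GaussianInputs

/-- The Gaussian inputs `(X₁, X₂, S, U)` as functions of i.i.d. standard Gaussian variables. -/
noncomputable def gaussianInputs (q a k w b v : ℝ) (x : Fin 5 → ℝ) : ℝ × ℝ × ℝ × ℝ :=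
  -- The coordinates are `U`, `V`, `W`, `S₀` in this order; coordinate `4` is reserved for the noise
  -- `Z`.
  (a * x 0 + k * x 3 + w * x 2, b * x 0 + v * x 1, q * x 3, x 0)

@[fun_prop]
lemma measurable_gaussianInputs (q a k w b v : ℝ) : Measurable (gaussianInputs q a k w b v) := by
  unfold gaussianInputs; fun_prop

noncomputable def gaussianInputLaw (q a k w b v : ℝ) : Measure (ℝ × ℝ × ℝ × ℝ) :=
  (stdNormal (Fin 5)).map (gaussianInputs q a k w b v)

instance (q a k w b v : ℝ) : IsProbabilityMeasure (gaussianInputLaw q a k w b v) :=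
  Measure.isProbabilityMeasure_map (by fun_prop)

variable (q a k w b v : ℝ)

lemma stdNormal_map_eq (f : (Fin 5 → ℝ) → ℝ) (c : Fin 5 → ℝ) (hf : ∀ x, f x = ∑ i, c i * x i)
    {t : ℝ≥0} (ht : ∑ i, c i ^ 2 = t) : (stdNormal (Fin 5)).map f = gaussianReal 0 t := by
  rw [funext hf, stdNormal_map_sum, ht, Real.toNNReal_coe]

/-- With inputs and noise on one standard Gaussian space, laws and independence are read off from
coefficient vectors. -/
lemma withNoise_gaussianInputLaw :
    withNoise (gaussianInputLaw q a k w b v)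
      = (stdNormal (Fin 5)).map fun x => (gaussianInputs q a k w b v x, x 4) := by
  have h : IndepFun (gaussianInputs q a k w b v) (fun x => x 4) (stdNormal (Fin 5)) := by
    refine indepFun_stdNormal {0, 1, 2, 3} (by fun_prop) (by fun_prop) (fun x => ?_) (fun x => ?_)
    · simp [gaussianInputs]
    · simp
  rw [indepFun_iff_map_prod_eq_prod_map_map (by fun_prop)
    (measurable_pi_apply 4).aemeasurable] at h
  rw [h, stdNormal_map_eq (fun x => x 4) ![0, 0, 0, 0, 1] (t := 1)
    (fun x => by simp [Fin.sum_univ_five]) (by simp [Fin.sum_univ_five])]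
  rfl

lemma withNoise_map_eq {f : (ℝ × ℝ × ℝ × ℝ) × ℝ → ℝ} (hf : Measurable f) (c : Fin 5 → ℝ)
    (hfc : ∀ x, f (gaussianInputs q a k w b v x, x 4) = ∑ i, c i * x i) {t : ℝ≥0}
    (ht : ∑ i, c i ^ 2 = t) :
    (withNoise (gaussianInputLaw q a k w b v)).map f = gaussianReal 0 t := by
  rw [withNoise_gaussianInputLaw, Measure.map_map hf (by fun_prop)]
  exact stdNormal_map_eq _ c hfc ht

lemma withNoise_indepFun {β β' : Type*} [MeasurableSpace β] [MeasurableSpace β']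
    {f : (ℝ × ℝ × ℝ × ℝ) × ℝ → β} {g : (ℝ × ℝ × ℝ × ℝ) × ℝ → β'} (hf : Measurable f)
    (hg : Measurable g) (s : Finset (Fin 5))
    (hfs : ∀ x : Fin 5 → ℝ, f (gaussianInputs q a k w b v x, x 4)
      = f (gaussianInputs q a k w b v fun i => if i ∈ s then x i else 0,
          if 4 ∈ s then x 4 else 0))
    (hgs : ∀ x : Fin 5 → ℝ, g (gaussianInputs q a k w b v x, x 4)
      = g (gaussianInputs q a k w b v fun i => if i ∈ s then 0 else x i,
          if 4 ∈ s then 0 else x 4)) :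
    IndepFun f g (withNoise (gaussianInputLaw q a k w b v)) := by
  rw [withNoise_gaussianInputLaw]
  exact indepFun_map (by fun_prop) hf hg
    (indepFun_stdNormal s (by fun_prop) (by fun_prop) hfs hgs)

lemma lintegral_sq_of_map_eq_gaussianReal {Ω : Type*} [MeasurableSpace Ω] {μ : Measure Ω}
    {N : Ω → ℝ} (hN : Measurable N) {t : ℝ≥0} (hlaw : μ.map N = gaussianReal 0 t) :
    ∫⁻ ω, ENNReal.ofReal (N ω ^ 2) ∂μ = t := by
  rw [← ofReal_integral_eq_lintegral_ofReal
    (memLp_two_of_map_eq_gaussianReal hN hlaw).integrable_sq (ae_of_all _ fun _ => sq_nonneg _),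
    integral_sq_of_map_eq_gaussianReal hN hlaw, ENNReal.ofReal_coe_nnreal]

lemma admissible_gaussianInputLaw {P₁ P₂ Q : ℝ≥0} (h₁ : a ^ 2 + k ^ 2 + w ^ 2 ≤ P₁)
    (h₂ : b ^ 2 + v ^ 2 ≤ P₂) : Admissible P₁ P₂ Q (gaussianInputLaw (√(Q : ℝ)) a k w b v) where
  state := by
    rw [gaussianInputLaw, Measure.map_map (by fun_prop) (by fun_prop)]
    refine stdNormal_map_eq _ ![0, 0, 0, √(Q : ℝ), 0] (fun x => ?_) ?_
    · simp [Fin.sum_univ_five, gaussianInputs]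
    · simp [Fin.sum_univ_five]
  condIndep := by
    refine condIndepFun_of_add_gaussian (m := fun u => a * u) (G := fun x => x.1 - a * x.2.2.2)
      (v := (Real.toNNReal (k ^ 2 + w ^ 2))) (by fun_prop) (by fun_prop) (by fun_prop)
      (by fun_prop) (fun x => by ring) ?_ ?_
    · refine indepFun_map (by fun_prop) (by fun_prop) (by fun_prop)
        (indepFun_stdNormal {0, 1} (by fun_prop) (by fun_prop) (fun x => ?_) (fun x => ?_))
      · simp [gaussianInputs]
      · simp [gaussianInputs]; ring
    · rw [gaussianInputLaw, Measure.map_map (by fun_prop) (by fun_prop)]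
      refine stdNormal_map_eq _ ![0, 0, w, k, 0] (fun x => ?_) ?_
      · simp [Fin.sum_univ_five, gaussianInputs]; ring
      · rw [Real.coe_toNNReal _ (by positivity)]
        simp [Fin.sum_univ_five]; ring
  indep := by
    refine indepFun_map (by fun_prop) (by fun_prop) (by fun_prop)
        (indepFun_stdNormal {0, 1} (by fun_prop) (by fun_prop) (fun x => ?_) (fun x => ?_))
    · simp [gaussianInputs]
    · simp [gaussianInputs]
  power₁ := by
    rw [lintegral_sq_of_map_eq_gaussianReal (by fun_prop)
      (t := Real.toNNReal (a ^ 2 + k ^ 2 + w ^ 2)), ENNReal.coe_le_coe]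
    · exact Real.toNNReal_le_iff_le_coe.2 h₁
    · rw [gaussianInputLaw, Measure.map_map (by fun_prop) (by fun_prop)]
      refine stdNormal_map_eq _ ![a, 0, w, k, 0] (fun x => ?_) ?_
      · simp [Fin.sum_univ_five, gaussianInputs]; ring
      · rw [Real.coe_toNNReal _ (by positivity)]
        simp [Fin.sum_univ_five]; ring
  power₂ := by
    rw [lintegral_sq_of_map_eq_gaussianReal (by fun_prop)
      (t := Real.toNNReal (b ^ 2 + v ^ 2)), ENNReal.coe_le_coe]
    · exact Real.toNNReal_le_iff_le_coe.2 h₂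
    · rw [gaussianInputLaw, Measure.map_map (by fun_prop) (by fun_prop)]
      refine stdNormal_map_eq _ ![b, v, 0, 0, 0] (fun x => ?_) ?_
      · simp [Fin.sum_univ_five, gaussianInputs]
      · rw [Real.coe_toNNReal _ (by positivity)]
        simp [Fin.sum_univ_five]

variable {𝒰 : Type} [MeasurableSpace 𝒰]

@[fun_prop] lemma measurable_X₁ : Measurable (X₁ (𝒰 := 𝒰)) := by unfold X₁; fun_prop
@[fun_prop] lemma measurable_X₂ : Measurable (X₂ (𝒰 := 𝒰)) := by unfold X₂; fun_prop
@[fun_prop] lemma measurable_S : Measurable (S (𝒰 := 𝒰)) := by unfold S; fun_prop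
@[fun_prop] lemma measurable_U : Measurable (U (𝒰 := 𝒰)) := by unfold U; fun_prop
@[fun_prop] lemma measurable_Z : Measurable (Z (𝒰 := 𝒰)) := by unfold Z; fun_prop

lemma toNNReal_ne_zero_of_pos {x : ℝ} (hx : 0 < x) : Real.toNNReal x ≠ 0 := by
  simpa using hx

/-- Given `(X₁, S, U)`, the uncertain part of `Y` is `vV + Z`; once `X₂` is also given, only `Z`
remains. The other three bounds follow the same pattern. -/
lemma le_condMutualInfo_X₂_of_X₁_S_U :
    ENNReal.ofReal (Real.log (1 + v ^ 2) / 2) ≤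
      condMutualInfo (withNoise (gaussianInputLaw q a k w b v)) X₂ Y
        (fun ω => (X₁ ω, S ω, U ω)) := by
  have h := le_condMutualInfo_of_gaussian (μ := withNoise (gaussianInputLaw q a k w b v))
    (A := X₂) (B := Y) (C := fun ω => (X₁ ω, S ω, U ω)) (N := Z)
    (N' := fun ω => X₂ ω - b * U ω + Z ω) (m := fun p => p.1.1 + p.2 + p.1.2.1)
    (m' := fun p => p.1 + p.2.1 + b * p.2.2) (v := 1) (v' := Real.toNNReal (1 + v ^ 2))
    (by fun_prop) (by fun_prop) (by fun_prop) (by fun_prop) (by fun_prop) (by fun_prop)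
    one_ne_zero (toNNReal_ne_zero_of_pos (by positivity)) (fun ω => rfl)
    (fun ω => by simp only [Y]; ring) ?_ ?_ ?_ ?_
  · rwa [Real.coe_toNNReal _ (by positivity), NNReal.coe_one, div_one] at h
  · refine withNoise_indepFun _ _ _ _ _ _ (by fun_prop) (by fun_prop) {0, 1, 2, 3}
      (fun x => ?_) (fun x => ?_)
    · simp [gaussianInputs, X₁, X₂, S, U]
    · simp [Z]
  · refine withNoise_indepFun _ _ _ _ _ _ (by fun_prop) (by fun_prop) {0, 2, 3}
      (fun x => ?_) (fun x => ?_)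
    · simp [gaussianInputs, X₁, S, U]
    · simp [gaussianInputs, X₂, U, Z]
  · refine withNoise_map_eq _ _ _ _ _ _ (by fun_prop) ![0, 0, 0, 0, 1] (fun x => ?_) ?_
    · simp [Fin.sum_univ_five, Z]
    · simp [Fin.sum_univ_five]
  · refine withNoise_map_eq _ _ _ _ _ _ (by fun_prop) ![0, v, 0, 0, 1] (fun x => ?_) ?_
    · simp [Fin.sum_univ_five, gaussianInputs, X₂, U, Z]
    · rw [Real.coe_toNNReal _ (by positivity)]
      simp [Fin.sum_univ_five]; ring

lemma le_condMutualInfo_X₁_of_X₂_S_U (hqk : q = 0 → k = 0) :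
    ENNReal.ofReal (Real.log (1 + w ^ 2) / 2) ≤
      condMutualInfo (withNoise (gaussianInputLaw q a k w b v)) X₁ Y
        (fun ω => (X₂ ω, S ω, U ω)) := by
  -- The part `kS₀` of `X₁` is the multiple `(k/q) S` of the state, also for `q = 0`, where `k = 0`.
  have hS : ∀ t : ℝ, k / q * (q * t) = k * t := by
    intro t
    by_cases hq : q = 0
    · simp [hq, hqk hq]
    · field_simp
  have h := le_condMutualInfo_of_gaussian (μ := withNoise (gaussianInputLaw q a k w b v))
    (A := X₁) (B := Y) (C := fun ω => (X₂ ω, S ω, U ω)) (N := Z)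
    (N' := fun ω => X₁ ω - a * U ω - k / q * S ω + Z ω) (m := fun p => p.2 + p.1.1 + p.1.2.1)
    (m' := fun p => p.1 + p.2.1 + a * p.2.2 + k / q * p.2.1) (v := 1)
    (v' := Real.toNNReal (1 + w ^ 2))
    (by fun_prop) (by fun_prop) (by fun_prop) (by fun_prop) (by fun_prop) (by fun_prop)
    one_ne_zero (toNNReal_ne_zero_of_pos (by positivity)) (fun ω => rfl)
    (fun ω => by simp only [Y]; ring) ?_ ?_ ?_ ?_
  · rwa [Real.coe_toNNReal _ (by positivity), NNReal.coe_one, div_one] at h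
  · refine withNoise_indepFun _ _ _ _ _ _ (by fun_prop) (by fun_prop) {0, 1, 2, 3}
      (fun x => ?_) (fun x => ?_)
    · simp [gaussianInputs, X₁, X₂, S, U]
    · simp [Z]
  · refine withNoise_indepFun _ _ _ _ _ _ (by fun_prop) (by fun_prop) {0, 1, 3}
      (fun x => ?_) (fun x => ?_)
    · simp [gaussianInputs, X₂, S, U]
    · simp [gaussianInputs, X₁, S, U, Z, hS]; ring
  · refine withNoise_map_eq _ _ _ _ _ _ (by fun_prop) ![0, 0, 0, 0, 1] (fun x => ?_) ?_
    · simp [Fin.sum_univ_five, Z]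
    · simp [Fin.sum_univ_five]
  · refine withNoise_map_eq _ _ _ _ _ _ (by fun_prop) ![0, 0, w, 0, 1] (fun x => ?_) ?_
    · simp [Fin.sum_univ_five, gaussianInputs, X₁, S, U, Z, hS]; ring
    · rw [Real.coe_toNNReal _ (by positivity)]
      simp [Fin.sum_univ_five]; ring

/-- The interference `(k + q)S₀ + wW + Z` is the noise seen by a decoder that treats `X₁ - aU` and
`S` as noise, as in the next two bounds. -/
lemma withNoise_map_interference :
    (withNoise (gaussianInputLaw q a k w b v)).map (fun ω => X₁ ω - a * U ω + S ω + Z ω)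
      = gaussianReal 0 (Real.toNNReal ((k + q) ^ 2 + w ^ 2 + 1)) := by
  refine withNoise_map_eq _ _ _ _ _ _ (by fun_prop) ![0, 0, w, k + q, 1] (fun x => ?_) ?_
  · simp [Fin.sum_univ_five, gaussianInputs, X₁, S, U, Z]; ring
  · rw [Real.coe_toNNReal _ (by positivity)]
    simp [Fin.sum_univ_five]; ring

lemma le_condMutualInfo_X₂_of_U :
    ENNReal.ofReal (Real.log (((k + q) ^ 2 + w ^ 2 + 1 + v ^ 2) / ((k + q) ^ 2 + w ^ 2 + 1)) / 2) ≤
      condMutualInfo (withNoise (gaussianInputLaw q a k w b v)) X₂ Y U := by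
  have h := le_condMutualInfo_of_gaussian (μ := withNoise (gaussianInputLaw q a k w b v))
    (A := X₂) (B := Y) (C := U) (N := fun ω => X₁ ω - a * U ω + S ω + Z ω)
    (N' := fun ω => X₁ ω - a * U ω + S ω + Z ω + (X₂ ω - b * U ω)) (m := fun p => p.2 + a * p.1)
    (m' := fun p => (a + b) * p) (v := Real.toNNReal ((k + q) ^ 2 + w ^ 2 + 1))
    (v' := Real.toNNReal ((k + q) ^ 2 + w ^ 2 + 1 + v ^ 2))
    (by fun_prop) (by fun_prop) (by fun_prop) (by fun_prop) (by fun_prop) (by fun_prop)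
    (toNNReal_ne_zero_of_pos (by positivity)) (toNNReal_ne_zero_of_pos (by positivity))
    (fun ω => by simp only [Y]; ring) (fun ω => by simp only [Y]; ring) ?_ ?_
    (withNoise_map_interference _ _ _ _ _ _) ?_
  · rwa [Real.coe_toNNReal _ (by positivity), Real.coe_toNNReal _ (by positivity)] at h
  · refine withNoise_indepFun _ _ _ _ _ _ (by fun_prop) (by fun_prop) {0, 1}
      (fun x => ?_) (fun x => ?_)
    · simp [gaussianInputs, X₂, U]
    · simp [gaussianInputs, X₁, S, U, Z]; ring
  · refine withNoise_indepFun _ _ _ _ _ _ (by fun_prop) (by fun_prop) {0}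
      (fun x => ?_) (fun x => ?_)
    · simp [gaussianInputs, U]
    · simp [gaussianInputs, X₁, X₂, S, U, Z]; ring
  · refine withNoise_map_eq _ _ _ _ _ _ (by fun_prop) ![0, v, w, k + q, 1] (fun x => ?_) ?_
    · simp [Fin.sum_univ_five, gaussianInputs, X₁, X₂, S, U, Z]; ring
    · rw [Real.coe_toNNReal _ (by positivity)]
      simp [Fin.sum_univ_five]; ring

lemma le_mutualInfo_X₂_U :
    ENNReal.ofReal (Real.log (((k + q) ^ 2 + w ^ 2 + 1 + v ^ 2 + (a + b) ^ 2) /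
      ((k + q) ^ 2 + w ^ 2 + 1)) / 2) ≤
      mutualInfo (withNoise (gaussianInputLaw q a k w b v)) (fun ω => (X₂ ω, U ω)) Y := by
  have h := le_mutualInfo_of_gaussian (μ := withNoise (gaussianInputLaw q a k w b v))
    (A := fun ω => (X₂ ω, U ω)) (B := Y) (N := fun ω => X₁ ω - a * U ω + S ω + Z ω)
    (m := fun p => p.1 + a * p.2) (v := Real.toNNReal ((k + q) ^ 2 + w ^ 2 + 1))
    (v' := Real.toNNReal ((k + q) ^ 2 + w ^ 2 + 1 + v ^ 2 + (a + b) ^ 2))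
    (by fun_prop) (by fun_prop) (by fun_prop)
    (toNNReal_ne_zero_of_pos (by positivity)) (toNNReal_ne_zero_of_pos (by positivity))
    (fun ω => by simp only [Y]; ring) ?_ (withNoise_map_interference _ _ _ _ _ _) ?_
  · rwa [Real.coe_toNNReal _ (by positivity), Real.coe_toNNReal _ (by positivity)] at h
  · refine withNoise_indepFun _ _ _ _ _ _ (by fun_prop) (by fun_prop) {0, 1}
      (fun x => ?_) (fun x => ?_)
    · simp [gaussianInputs, X₂, U]
    · simp [gaussianInputs, X₁, S, U, Z]; ring
  · refine withNoise_map_eq _ _ _ _ _ _ (by unfold Y; fun_prop) ![a + b, v, w, k + q, 1]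
      (fun x => ?_) ?_
    · simp [Fin.sum_univ_five, gaussianInputs, Y, X₁, X₂, S, Z]; ring
    · rw [Real.coe_toNNReal _ (by positivity)]
      simp [Fin.sum_univ_five]; ring

end GaussianInputs

theorem gaussianRegion_subset_outerRegionDeg (P₁ P₂ Q : ℝ≥0) :
    gaussianRegion P₁ P₂ Q ⊆ outerRegionDeg P₁ P₂ Q := by
  rintro ⟨R₁, R₂⟩ ⟨a, k, w, b, v, h₁, h₂, hQ, hR₁, hR₂, hR₃⟩
  have hqk : √(Q : ℝ) = 0 → k = 0 := by
    intro h
    refine hQ ?_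
    simpa using h
  refine ⟨ℝ, inferInstance, inferInstance, gaussianInputLaw (√(Q : ℝ)) a k w b v, inferInstance,
    admissible_gaussianInputLaw a k w b v h₁ h₂, ?_, ?_, ?_⟩
  · exact (ENNReal.ofReal_le_ofReal hR₁).trans (le_condMutualInfo_X₂_of_X₁_S_U _ _ _ _ _ _)
  · exact (ENNReal.ofReal_le_ofReal hR₂).trans (ENNReal.ofReal_add_le.trans (add_le_add
      (le_condMutualInfo_X₁_of_X₂_S_U _ _ _ _ _ _ hqk) (le_condMutualInfo_X₂_of_U _ _ _ _ _ _)))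
  · exact (ENNReal.ofReal_le_ofReal hR₃).trans (ENNReal.ofReal_add_le.trans (add_le_add
      (le_condMutualInfo_X₁_of_X₂_S_U _ _ _ _ _ _ hqk) (le_mutualInfo_X₂_U _ _ _ _ _ _)))

/-! ### Densities of Gaussian vectors and changes of measure -/

section GaussianVectors

variable {n : ℕ}

lemma lintegral_fin_prod_volume_eq_prod (f : Fin n → ℝ → ℝ≥0∞) (hf : ∀ i, Measurable (f i)) :
    ∫⁻ x : Fin n → ℝ, ∏ i, f i (x i) = ∏ i, ∫⁻ t, f i t := by
  induction n with
  | zero => simp [volume_pi]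
  | succ n ih =>
    have h := (volume_preserving_piFinSuccAbove (fun _ : Fin (n + 1) => ℝ) 0).symm.lintegral_comp
      (f := fun x => ∏ i, f i (x i)) (by fun_prop)
    have hm : Measurable fun x : Fin n → ℝ => ∏ i : Fin n, f i.succ (x i) := by fun_prop
    rw [← h, Measure.volume_eq_prod, lintegral_prod _ (by fun_prop)]
    simp only [MeasurableEquiv.piFinSuccAbove_symm_apply, Fin.insertNthEquiv_zero,
      Fin.consEquiv_apply, Fin.cons_zero, Fin.cons_succ, Fin.prod_univ_succ]
    simp_rw [lintegral_const_mul _ hm]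
    rw [lintegral_mul_const _ (hf 0), ih _ fun i => hf i.succ]

/-- The law of `n` i.i.d. `N(0, v)` variables. -/
noncomputable abbrev gaussianPi (n : ℕ) (v : ℝ≥0) : Measure (Fin n → ℝ) :=
  Measure.pi fun _ => gaussianReal 0 v

/-- The logarithm of the density of `gaussianPi n v`. -/
noncomputable def logDensity (v : ℝ≥0) (x : Fin n → ℝ) : ℝ :=
  ∑ i, (-(Real.log (2 * Real.pi) / 2) - Real.log v / 2 - x i ^ 2 / (2 * v))

@[fun_prop]
lemma measurable_logDensity (v : ℝ≥0) : Measurable (logDensity (n := n) v) := by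
  unfold logDensity; fun_prop

lemma gaussianPi_eq_withDensity {v : ℝ≥0} (hv : v ≠ 0) :
    gaussianPi n v = volume.withDensity fun x => ENNReal.ofReal (Real.exp (logDensity v x)) := by
  refine Measure.pi_eq fun s hs => ?_
  have h : ∀ x : Fin n → ℝ, ENNReal.ofReal (Real.exp (logDensity v x))
      = ∏ i, gaussianPDF 0 v (x i) := by
    intro x
    rw [logDensity, Real.exp_sum, ENNReal.ofReal_prod_of_nonneg fun _ _ => (Real.exp_pos _).le]
    simp [gaussianPDF, gaussianPDFReal_eq_exp _ hv]
  rw [withDensity_apply _ (MeasurableSet.univ_pi hs), ← lintegral_indicator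
    (MeasurableSet.univ_pi hs)]
  have h' : ∀ x : Fin n → ℝ, (Set.univ.pi s).indicator
      (fun x => ENNReal.ofReal (Real.exp (logDensity v x))) x
      = ∏ i, (s i).indicator (gaussianPDF 0 v) (x i) := by
    intro x
    by_cases hx : x ∈ Set.univ.pi s
    · rw [Set.indicator_of_mem hx, h]
      exact Finset.prod_congr rfl fun i _ => (Set.indicator_of_mem (hx i trivial) _).symm
    · rw [Set.indicator_of_notMem hx]
      simp only [Set.mem_pi, Set.mem_univ, true_implies, not_forall] at hx
      obtain ⟨i, hi⟩ := hx
      exact (Finset.prod_eq_zero (Finset.mem_univ i) (Set.indicator_of_notMem hi _)).symm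
  simp_rw [h']
  rw [lintegral_fin_prod_volume_eq_prod _ fun i => (measurable_gaussianPDF 0 v).indicator (hs i)]
  refine Finset.prod_congr rfl fun i _ => ?_
  rw [lintegral_indicator (hs i), gaussianReal_apply _ hv]

lemma lintegral_gaussianPi {v : ℝ≥0} (hv : v ≠ 0) {f : (Fin n → ℝ) → ℝ≥0∞} (hf : Measurable f) :
    ∫⁻ x, f x ∂gaussianPi n v = ∫⁻ x, ENNReal.ofReal (Real.exp (logDensity v x)) * f x := by
  rw [gaussianPi_eq_withDensity hv, lintegral_withDensity_eq_lintegral_mul _ (by fun_prop) hf]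
  rfl

lemma ofReal_exp_mul_ofReal_exp_sub (x y : ℝ) :
    ENNReal.ofReal (Real.exp x) * ENNReal.ofReal (Real.exp (y - x))
      = ENNReal.ofReal (Real.exp y) := by
  rw [← ENNReal.ofReal_mul (Real.exp_pos _).le, ← Real.exp_add, add_sub_cancel]

/-- Change of measure from the noise `z` to a Gaussian output `y = x + z` centred at `μ`. -/
lemma lintegral_exp_output {v : ℝ≥0} (hv : v ≠ 0) (x μ : Fin n → ℝ) {h : (Fin n → ℝ) → ℝ≥0∞}
    (hh : Measurable h) :
    ∫⁻ z, ENNReal.ofReal (Real.exp (logDensity v (x + z - μ) - logDensity 1 z)) * h (x + z)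
      ∂gaussianPi n 1 = ∫⁻ y, h (μ + y) ∂gaussianPi n v := by
  rw [lintegral_gaussianPi one_ne_zero (by fun_prop), lintegral_gaussianPi hv (by fun_prop)]
  simp_rw [← mul_assoc, ofReal_exp_mul_ofReal_exp_sub]
  -- The noise density has cancelled, leaving a Lebesgue integral; this translation turns `x + z`
  -- into `μ + z`.
  rw [← lintegral_add_left_eq_self _ (μ - x)]
  refine lintegral_congr fun z => ?_
  have hz : x + (μ - x + z) = μ + z := by abel
  rw [hz, add_sub_cancel_left]

/-- Change of measure from state and noise `(s, z)` to a Gaussian output `y = x s + z` centred at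
`μ` and a state that is Gaussian around the linear estimate `g (y - ρ)`. -/
lemma lintegral_exp_state_output {v t Q : ℝ≥0} (hv : v ≠ 0) (ht : t ≠ 0) (hQ : Q ≠ 0) (g : ℝ)
    (x : (Fin n → ℝ) → Fin n → ℝ) (μ ρ : Fin n → ℝ)
    {h : (Fin n → ℝ) → ℝ≥0∞} (hh : Measurable h) :
    ∫⁻ s, ∫⁻ z, ENNReal.ofReal (Real.exp (logDensity v (x s + z - μ) +
        logDensity t (s - g • (x s + z - ρ)) - logDensity Q s - logDensity 1 z)) * h (x s + z)
      ∂gaussianPi n 1 ∂gaussianPi n Q = ∫⁻ y, h (μ + y) ∂gaussianPi n v := by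
  have hin : ∀ s, ∫⁻ z, ENNReal.ofReal (Real.exp (logDensity v (x s + z - μ) +
        logDensity t (s - g • (x s + z - ρ)) - logDensity Q s - logDensity 1 z)) * h (x s + z)
      ∂gaussianPi n 1 = ∫⁻ y, ENNReal.ofReal (Real.exp (logDensity v (y - μ) +
        logDensity t (s - g • (y - ρ)) - logDensity Q s)) * h y := by
    intro s
    rw [lintegral_gaussianPi one_ne_zero (by fun_prop)]
    simp_rw [← mul_assoc, ofReal_exp_mul_ofReal_exp_sub]
    rw [lintegral_add_left_eq_self (fun y => ENNReal.ofReal (Real.exp (logDensity v (y - μ) +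
        logDensity t (s - g • (y - ρ)) - logDensity Q s)) * h y) (x s)]
  simp_rw [hin]
  rw [lintegral_gaussianPi hQ (Measurable.lintegral_prod_right' (f := fun p : (Fin n → ℝ) ×
    (Fin n → ℝ) => ENNReal.ofReal (Real.exp (logDensity v (p.2 - μ) +
        logDensity t (p.1 - g • (p.2 - ρ)) - logDensity Q p.1)) * h p.2) (by fun_prop))]
  have hmul : ∀ s : Fin n → ℝ, ENNReal.ofReal (Real.exp (logDensity Q s)) *
      ∫⁻ y, ENNReal.ofReal (Real.exp (logDensity v (y - μ) +
        logDensity t (s - g • (y - ρ)) - logDensity Q s)) * h y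
      = ∫⁻ y, ENNReal.ofReal (Real.exp (logDensity v (y - μ) +
        logDensity t (s - g • (y - ρ)))) * h y := by
    intro s
    rw [← lintegral_const_mul _ (by fun_prop)]
    simp_rw [← mul_assoc, ofReal_exp_mul_ofReal_exp_sub]
  simp_rw [hmul]
  rw [lintegral_lintegral_swap (by fun_prop), lintegral_gaussianPi hv (by fun_prop),
    ← lintegral_add_left_eq_self _ μ]
  refine lintegral_congr fun y => ?_
  -- The conditional state density has mass one whatever its centre, so `ρ` may depend on both
  -- messages without affecting the law of the output.
  have hone : ∫⁻ s : Fin n → ℝ, ENNReal.ofReal (Real.exp (logDensity t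
      (s - g • (μ + y - ρ)))) = 1 := by
    rw [← lintegral_add_left_eq_self _ (g • (μ + y - ρ))]
    have h1 := lintegral_gaussianPi (n := n) ht (f := fun _ => 1) measurable_const
    simp only [lintegral_const, measure_univ, mul_one] at h1
    rw [h1]
    refine lintegral_congr fun s => ?_
    rw [add_sub_cancel_left]
  simp_rw [Real.exp_add, ENNReal.ofReal_mul (Real.exp_pos _).le, mul_right_comm _ _ (h (μ + y))]
  rw [lintegral_const_mul _ (by fun_prop), hone, mul_one, add_sub_cancel_left]

end GaussianVectors

/-! ### Fano's inequality by change of measure -/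

section ChangeOfMeasure

/-- A change-of-measure form of Fano's inequality: if `exp L` is the density of a subprobability
measure that gives the event `E` mass at most `1 / M`, then `P(E) log M - log 2 ≤ E[-L]`. -/
lemma measureReal_mul_log_sub_log_two_le {Ω : Type*} [MeasurableSpace Ω] {P : Measure Ω}
    [IsProbabilityMeasure P] {E : Set Ω} (hE : MeasurableSet E) {L : Ω → ℝ} (hLm : Measurable L)
    (hL : Integrable L P) {M : ℝ} (hM : 1 ≤ M)
    (h₀ : ∫⁻ ω, ENNReal.ofReal (Real.exp (L ω)) ∂P ≤ 1)
    (h₁ : ∫⁻ ω in E, ENNReal.ofReal (Real.exp (L ω)) ∂P ≤ ENNReal.ofReal (1 / M)) :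
    P.real E * Real.log M - Real.log 2 ≤ -∫ ω, L ω ∂P := by
  have hM0 : 0 < M := by linarith
  have hexp : Integrable (fun ω => Real.exp (L ω)) P := by
    refine (lintegral_ofReal_ne_top_iff_integrable (by fun_prop)
      (ae_of_all _ fun _ => (Real.exp_pos _).le)).1 (h₀.trans_lt ENNReal.one_lt_top).ne
  have h₀' : ∫ ω, Real.exp (L ω) ∂P ≤ 1 := by
    rw [integral_eq_lintegral_of_nonneg_ae (ae_of_all _ fun _ => (Real.exp_pos _).le)
      (by fun_prop)]
    exact ENNReal.toReal_le_of_le_ofReal zero_le_one (by simpa using h₀)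
  have h₁' : ∫ ω in E, Real.exp (L ω) ∂P ≤ 1 / M := by
    rw [integral_eq_lintegral_of_nonneg_ae (ae_of_all _ fun _ => (Real.exp_pos _).le)
      (by fun_prop)]
    exact ENNReal.toReal_le_of_le_ofReal (by positivity) h₁
  -- This is `1 + x ≤ exp x` at `x = 1_E log M - log 2 + L`, together with `M ^ 1_E ≤ M 1_E + 1`.
  -- The right-hand side integrates to at most `(1 + 1)/2 - 1 = 0`.
  have hpt : ∀ ω, E.indicator (fun _ => Real.log M) ω - Real.log 2 + L ω
      ≤ 2⁻¹ * (M * E.indicator (fun ω => Real.exp (L ω)) ω + Real.exp (L ω)) - 1 := by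
    intro ω
    have h := Real.add_one_le_exp (E.indicator (fun _ => Real.log M) ω - Real.log 2 + L ω)
    have h2 : Real.exp (E.indicator (fun _ => Real.log M) ω - Real.log 2 + L ω)
        ≤ 2⁻¹ * (M * E.indicator (fun ω => Real.exp (L ω)) ω + Real.exp (L ω)) := by
      rw [Real.exp_add, Real.exp_sub, Real.exp_log two_pos]
      have := Real.exp_pos (L ω)
      by_cases hω : ω ∈ E
      · simp only [Set.indicator_of_mem hω, Real.exp_log hM0]; nlinarith
      · simp only [Set.indicator_of_notMem hω, Real.exp_zero]; nlinarith
    linarith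
  have i1 : Integrable (E.indicator fun _ => Real.log M) P :=
    (integrable_const _).indicator hE
  have i2 : Integrable (E.indicator fun ω => Real.exp (L ω)) P := hexp.indicator hE
  have i3 : Integrable (fun ω => E.indicator (fun _ => Real.log M) ω - Real.log 2) P :=
    i1.sub (integrable_const _)
  have i4 : Integrable (fun ω => M * E.indicator (fun ω => Real.exp (L ω)) ω
    + Real.exp (L ω)) P := (i2.const_mul M).add hexp
  have hle := integral_mono (i3.add hL) ((i4.const_mul 2⁻¹).sub (integrable_const 1)) hpt
  rw [integral_add' i3 hL, integral_sub i1 (integrable_const _),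
    integral_sub' (i4.const_mul 2⁻¹) (integrable_const 1), integral_const_mul,
    integral_add (i2.const_mul M) hexp, integral_const_mul, integral_indicator hE,
    integral_indicator hE, setIntegral_const] at hle
  simp only [integral_const, probReal_univ, smul_eq_mul, one_mul] at hle
  have h3 : M * ∫ ω in E, Real.exp (L ω) ∂P ≤ 1 := by
    calc _ ≤ M * (1 / M) := by gcongr
      _ = 1 := by field_simp
  linarith

end ChangeOfMeasure

/-! ### Measurability of codes, averages over outcomes, and Fano's inequality for codes -/

namespace Code

variable {n m₁ m₂ : ℕ}

lemma measurable_input₁ (c : Code n m₁ m₂) : Measurable c.input₁ := by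
  have h : Measurable fun p : Fin m₁ × (Fin n → ℝ) => c.enc₁ p.1 p.2 :=
    measurable_from_prod_countable_right c.measurable_enc₁
  exact h.comp (by fun_prop : Measurable fun ω : Outcome n m₁ m₂ => (ω.1.1, ω.2.1))

lemma measurable_input₂ (c : Code n m₁ m₂) : Measurable c.input₂ :=
  (measurable_of_countable fun p : Fin m₁ × Fin m₂ => c.enc₂ p.1 p.2).comp measurable_fst

lemma measurable_output (c : Code n m₁ m₂) : Measurable c.output := by
  have := c.measurable_input₁
  have := c.measurable_input₂
  unfold output
  fun_prop

lemma measurableSet_correct (c : Code n m₁ m₂) : MeasurableSet {ω | c.dec (c.output ω) = ω.1} :=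
  measurableSet_eq_fun (c.measurable_dec.comp c.measurable_output) measurable_fst

end Code

section OutcomeLaw

variable {n m₁ m₂ : ℕ}

lemma lintegral_uniformOn_fin {m : ℕ} (f : Fin m → ℝ≥0∞) :
    ∫⁻ a, f a ∂uniformOn (Set.univ : Set (Fin m)) = (m : ℝ≥0∞)⁻¹ * ∑ a, f a := by
  rw [lintegral_fintype, Finset.mul_sum]
  refine Finset.sum_congr rfl fun a _ => ?_
  rw [uniformOn_univ, mul_comm]
  simp

lemma lintegral_outcomeLaw (Q : ℝ≥0) {f : Outcome n m₁ m₂ → ℝ≥0∞} (hf : Measurable f) :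
    ∫⁻ ω, f ω ∂outcomeLaw n m₁ m₂ Q = (m₁ : ℝ≥0∞)⁻¹ * ∑ a, (m₂ : ℝ≥0∞)⁻¹ * ∑ b,
      ∫⁻ s, ∫⁻ z, f ((a, b), (s, z)) ∂gaussianPi n 1 ∂gaussianPi n Q := by
  have : SFinite (uniformOn (Set.univ : Set (Fin m₁))) := by unfold uniformOn; infer_instance
  have : SFinite (uniformOn (Set.univ : Set (Fin m₂))) := by unfold uniformOn; infer_instance
  rw [outcomeLaw, lintegral_prod _ hf.aemeasurable, lintegral_prod _ (by fun_prop),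
    lintegral_uniformOn_fin]
  congr 1
  refine Finset.sum_congr rfl fun a _ => ?_
  rw [lintegral_uniformOn_fin]
  congr 1
  refine Finset.sum_congr rfl fun b _ => ?_
  rw [lintegral_prod _ (by fun_prop)]

instance [NeZero m₁] [NeZero m₂] (Q : ℝ≥0) : IsProbabilityMeasure (outcomeLaw n m₁ m₂ Q) := by
  unfold outcomeLaw; infer_instance

namespace Code

lemma sum_measure_dec_preimage_le (c : Code n m₁ m₂) (q : Measure (Fin n → ℝ))
    [IsProbabilityMeasure q] : ∑ a, ∑ b, q (c.dec ⁻¹' {(a, b)}) ≤ 1 := by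
  rw [← Finset.sum_product' (f := fun a b => q (c.dec ⁻¹' {(a, b)})),
    sum_measure_preimage_singleton _ fun y _ => c.measurable_dec (measurableSet_singleton y)]
  exact prob_le_one

variable [NeZero m₁] [NeZero m₂]

/-- Fano's inequality for a code and a reference law `exp L` under which the output, given the
messages `(a, b)`, has law `q a b`. -/
lemma one_sub_errorProb_mul_log_le (c : Code n m₁ m₂) (Q : ℝ≥0) {L : Outcome n m₁ m₂ → ℝ}
    (hLm : Measurable L) (hL : Integrable L (outcomeLaw n m₁ m₂ Q))
    (q : Fin m₁ → Fin m₂ → Measure (Fin n → ℝ)) [∀ a b, IsProbabilityMeasure (q a b)]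
    (hq : ∀ a b, ∀ h : (Fin n → ℝ) → ℝ≥0∞, Measurable h →
      ∫⁻ s, ∫⁻ z, ENNReal.ofReal (Real.exp (L ((a, b), (s, z)))) * h (c.output ((a, b), (s, z)))
        ∂gaussianPi n 1 ∂gaussianPi n Q = ∫⁻ y, h y ∂q a b)
    {M : ℕ} (hM : 1 ≤ M)
    (hdec : (m₁ : ℝ≥0∞)⁻¹ * ∑ a, (m₂ : ℝ≥0∞)⁻¹ * ∑ b, q a b (c.dec ⁻¹' {(a, b)})
      ≤ (M : ℝ≥0∞)⁻¹) :
    (1 - (c.errorProb Q).toReal) * Real.log M - Real.log 2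
      ≤ -∫ ω, L ω ∂outcomeLaw n m₁ m₂ Q := by
  have hm₁ : (m₁ : ℝ≥0∞) ≠ 0 := by simpa using NeZero.ne m₁
  have hm₂ : (m₂ : ℝ≥0∞) ≠ 0 := by simpa using NeZero.ne m₂
  have hY := c.measurable_output
  have hE := c.measurableSet_correct
  have herr : 1 - (c.errorProb Q).toReal
      = (outcomeLaw n m₁ m₂ Q).real {ω | c.dec (c.output ω) = ω.1} := by
    rw [← compl_compl {ω | c.dec (c.output ω) = ω.1}, probReal_compl_eq_one_sub hE.compl]
    rfl
  rw [herr]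
  refine measureReal_mul_log_sub_log_two_le hE hLm hL (by exact_mod_cast hM) ?_ ?_
  · rw [lintegral_outcomeLaw _ (by fun_prop)]
    have h1 : ∀ a b, ∫⁻ s, ∫⁻ z, ENNReal.ofReal (Real.exp (L ((a, b), (s, z))))
        ∂gaussianPi n 1 ∂gaussianPi n Q = 1 := by
      intro a b
      have := hq a b (fun _ => 1) measurable_const
      simpa using this
    simp only [h1, Finset.sum_const, Finset.card_univ, Fintype.card_fin, nsmul_eq_mul, mul_one]
    rw [ENNReal.inv_mul_cancel hm₂ (by simp), mul_one, ENNReal.inv_mul_cancel hm₁ (by simp)]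
  · have h1 : ∀ a b, ∫⁻ s, ∫⁻ z, ENNReal.ofReal (Real.exp (L ((a, b), (s, z)))) *
        (c.dec ⁻¹' {(a, b)}).indicator 1 (c.output ((a, b), (s, z)))
        ∂gaussianPi n 1 ∂gaussianPi n Q = q a b (c.dec ⁻¹' {(a, b)}) := by
      intro a b
      have hs := c.measurable_dec (measurableSet_singleton (a, b))
      rw [hq a b _ (measurable_one.indicator hs), lintegral_indicator_one hs]
    have h2 : ∫⁻ ω in {ω | c.dec (c.output ω) = ω.1}, ENNReal.ofReal (Real.exp (L ω))
        ∂outcomeLaw n m₁ m₂ Q = (m₁ : ℝ≥0∞)⁻¹ * ∑ a, (m₂ : ℝ≥0∞)⁻¹ * ∑ b,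
          q a b (c.dec ⁻¹' {(a, b)}) := by
      rw [← lintegral_indicator hE, lintegral_outcomeLaw _ (Measurable.indicator (by fun_prop) hE)]
      simp_rw [← h1]
      congr 1
      refine Finset.sum_congr rfl fun a _ => ?_
      congr 1
      refine Finset.sum_congr rfl fun b _ => ?_
      refine lintegral_congr fun s => lintegral_congr fun z => ?_
      by_cases h : c.dec (c.output ((a, b), (s, z))) = (a, b) <;> simp [Set.indicator, h]
    rw [h2]
    refine hdec.trans (le_of_eq ?_)
    rw [one_div, ENNReal.ofReal_inv_of_pos (by positivity), ENNReal.ofReal_natCast]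

/-- For fixed `a` the decoding sets of the pairs `(a, b)` are disjoint and `q a` ignores `b`, so
their average mass over `b` is at most `1 / m₂`. -/
lemma one_sub_errorProb_mul_log_card₂_le (c : Code n m₁ m₂) (Q : ℝ≥0)
    {L : Outcome n m₁ m₂ → ℝ} (hLm : Measurable L) (hL : Integrable L (outcomeLaw n m₁ m₂ Q))
    (q : Fin m₁ → Measure (Fin n → ℝ)) [∀ a, IsProbabilityMeasure (q a)]
    (hq : ∀ a b, ∀ h : (Fin n → ℝ) → ℝ≥0∞, Measurable h →
      ∫⁻ s, ∫⁻ z, ENNReal.ofReal (Real.exp (L ((a, b), (s, z)))) * h (c.output ((a, b), (s, z)))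
        ∂gaussianPi n 1 ∂gaussianPi n Q = ∫⁻ y, h y ∂q a) :
    (1 - (c.errorProb Q).toReal) * Real.log m₂ - Real.log 2
      ≤ -∫ ω, L ω ∂outcomeLaw n m₁ m₂ Q := by
  have hm₁ : (m₁ : ℝ≥0∞) ≠ 0 := by simpa using NeZero.ne m₁
  refine c.one_sub_errorProb_mul_log_le Q hLm hL (fun a _ => q a) hq
    (Nat.one_le_iff_ne_zero.2 (NeZero.ne m₂)) ?_
  calc (m₁ : ℝ≥0∞)⁻¹ * ∑ a, (m₂ : ℝ≥0∞)⁻¹ * ∑ b, q a (c.dec ⁻¹' {(a, b)})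
      ≤ (m₁ : ℝ≥0∞)⁻¹ * ∑ _a : Fin m₁, (m₂ : ℝ≥0∞)⁻¹ * 1 := by
        gcongr with a
        exact (Finset.single_le_sum (f := fun a' => ∑ b, q a (c.dec ⁻¹' {(a', b)}))
          (fun _ _ => zero_le) (Finset.mem_univ a)).trans (c.sum_measure_dec_preimage_le (q a))
    _ = (m₂ : ℝ≥0∞)⁻¹ := by
        rw [Finset.sum_const, Finset.card_univ, Fintype.card_fin, nsmul_eq_mul, mul_one,
          ← mul_assoc, ENNReal.inv_mul_cancel hm₁ (by simp), one_mul]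

/-- Here the reference output ignores both messages, so the disjoint decoding sets have average mass
at most `1 / (m₁ m₂)`. -/
lemma one_sub_errorProb_mul_log_card_le (c : Code n m₁ m₂) (Q : ℝ≥0)
    {L : Outcome n m₁ m₂ → ℝ} (hLm : Measurable L) (hL : Integrable L (outcomeLaw n m₁ m₂ Q))
    (q : Measure (Fin n → ℝ)) [IsProbabilityMeasure q]
    (hq : ∀ a b, ∀ h : (Fin n → ℝ) → ℝ≥0∞, Measurable h →
      ∫⁻ s, ∫⁻ z, ENNReal.ofReal (Real.exp (L ((a, b), (s, z)))) * h (c.output ((a, b), (s, z)))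
        ∂gaussianPi n 1 ∂gaussianPi n Q = ∫⁻ y, h y ∂q) :
    (1 - (c.errorProb Q).toReal) * (Real.log m₁ + Real.log m₂) - Real.log 2
      ≤ -∫ ω, L ω ∂outcomeLaw n m₁ m₂ Q := by
  have h := c.one_sub_errorProb_mul_log_le Q hLm hL (fun _ _ => q) hq (M := m₁ * m₂)
    (Nat.one_le_iff_ne_zero.2 (mul_ne_zero (NeZero.ne m₁) (NeZero.ne m₂))) ?_
  · rwa [Nat.cast_mul, Real.log_mul (by simpa using NeZero.ne m₁)
      (by simpa using NeZero.ne m₂)] at h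
  · rw [← Finset.mul_sum, Nat.cast_mul, ENNReal.mul_inv (by simp) (by simp), ← mul_assoc]
    calc _ ≤ (m₁ : ℝ≥0∞)⁻¹ * (m₂ : ℝ≥0∞)⁻¹ * 1 := by
          gcongr
          exact c.sum_measure_dec_preimage_le q
      _ = _ := mul_one _

end Code

end OutcomeLaw

/-! ### Second-order statistics of a code -/

section SecondMoments

/-- Integrability can be omitted because a non-integrable function has integral `0` by convention.
-/
lemma integral_prod_eq_zero {α β : Type*} [MeasurableSpace α] [MeasurableSpace β] {μ : Measure α}
    {ν : Measure β} [SFinite μ] [SFinite ν] {f : α × β → ℝ}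
    (h : ∀ᵐ a ∂μ, ∫ b, f (a, b) ∂ν = 0) : ∫ p, f p ∂μ.prod ν = 0 := by
  by_cases hf : Integrable f (μ.prod ν)
  · rw [integral_prod _ hf, integral_congr_ae h, integral_zero]
  · exact integral_undef hf

lemma integral_sum_mul_sq {Ω ι : Type*} [MeasurableSpace Ω] [Fintype ι] {P : Measure Ω}
    {F : ι → Ω → ℝ} (hF : ∀ j, MemLp (F j) 2 P) (e : ι → ℝ) :
    Integrable (fun ω => (∑ j, e j * F j ω) ^ 2) P ∧
    ∫ ω, (∑ j, e j * F j ω) ^ 2 ∂P = ∑ j, ∑ k, e j * e k * ∫ ω, F j ω * F k ω ∂P := by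
  have hi : ∀ j k, Integrable (fun ω => e j * e k * (F j ω * F k ω)) P := fun j k =>
    ((hF j).integrable_mul (hF k)).const_mul _
  have hexp : ∀ ω, (∑ j, e j * F j ω) ^ 2 = ∑ j, ∑ k, e j * e k * (F j ω * F k ω) := by
    intro ω
    rw [sq, Finset.sum_mul_sum]
    exact Finset.sum_congr rfl fun j _ => Finset.sum_congr rfl fun k _ => by ring
  simp_rw [hexp]
  refine ⟨integrable_finsetSum _ fun j _ => integrable_finsetSum _ fun k _ => hi j k, ?_⟩
  rw [integral_finsetSum _ fun j _ => integrable_finsetSum _ fun k _ => hi j k]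
  refine Finset.sum_congr rfl fun j _ => ?_
  rw [integral_finsetSum _ fun k _ => hi j k]
  exact Finset.sum_congr rfl fun k _ => integral_const_mul _ _

end SecondMoments

namespace Code

variable {n m₁ m₂ : ℕ}

/-- The conditional mean of the input of user 1 given the first message. -/
noncomputable def condMean₁ (c : Code n m₁ m₂) (Q : ℝ≥0) (a : Fin m₁) (i : Fin n) : ℝ :=
  ∫ s, c.enc₁ a s i ∂gaussianPi n Q

/-- The conditional mean of the input of user 2 given the first message. -/
noncomputable def condMean₂ (c : Code n m₁ m₂) (a : Fin m₁) (i : Fin n) : ℝ :=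
  ∫ b, c.enc₂ a b i ∂uniformOn (Set.univ : Set (Fin m₂))

/-- The components of the channel output in the `i`-th channel use: the deviations of the inputs
from their conditional means, the state, the noise, and the conditional means of the inputs. -/
noncomputable def component (c : Code n m₁ m₂) (Q : ℝ≥0) (i : Fin n) :
    Fin 6 → Outcome n m₁ m₂ → ℝ :=
  ![fun ω => c.input₁ ω i - c.condMean₁ Q ω.1.1 i, fun ω => c.input₂ ω i - c.condMean₂ ω.1.1 i,
    fun ω => ω.2.1 i, fun ω => ω.2.2 i, fun ω => c.condMean₁ Q ω.1.1 i,
    fun ω => c.condMean₂ ω.1.1 i]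

lemma integral_eval_gaussianPi (v : ℝ≥0) (i : Fin n) : ∫ x, x i ∂gaussianPi n v = 0 := by
  rw [integral_comp_eval (μ := fun _ : Fin n => gaussianReal 0 v) (f := fun t : ℝ => t)
    (by fun_prop)]
  exact integral_id_gaussianReal

lemma integral_mul_noise_eq_zero (Q : ℝ≥0) (i : Fin n)
    (f : (Fin m₁ × Fin m₂) → (Fin n → ℝ) → ℝ) :
    ∫ ω, f ω.1 ω.2.1 * ω.2.2 i ∂outcomeLaw n m₁ m₂ Q = 0 := by
  refine integral_prod_eq_zero (ae_of_all _ fun m => integral_prod_eq_zero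
    (ae_of_all _ fun s => ?_))
  simp only
  rw [integral_const_mul, integral_eval_gaussianPi, mul_zero]

lemma integral_mul_state_eq_zero (Q : ℝ≥0) (i : Fin n) (f : (Fin m₁ × Fin m₂) → ℝ) :
    ∫ ω, f ω.1 * ω.2.1 i ∂outcomeLaw n m₁ m₂ Q = 0 := by
  refine integral_prod_eq_zero (ae_of_all _ fun m => ?_)
  simp only
  rw [integral_const_mul, integral_fun_fst (f := fun s : Fin n → ℝ => s i),
    integral_eval_gaussianPi, smul_zero, mul_zero]

lemma integral_mul_deviation₁_eq_zero (c : Code n m₁ m₂) (Q : ℝ≥0) (i : Fin n)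
    (hc : Integrable (fun ω => c.input₁ ω i) (outcomeLaw n m₁ m₂ Q))
    (f : (Fin m₁ × Fin m₂) → ℝ) :
    ∫ ω, f ω.1 * (c.input₁ ω i - c.condMean₁ Q ω.1.1 i) ∂outcomeLaw n m₁ m₂ Q = 0 := by
  refine integral_prod_eq_zero ?_
  filter_upwards [Integrable.prod_right_ae hc] with m hm
  simp only [input₁] at hm ⊢
  rw [integral_const_mul, integral_sub hm (integrable_const _),
    integral_fun_fst (f := fun s : Fin n → ℝ => c.enc₁ m.1 s i)]
  simp [condMean₁]

lemma integral_mul_deviation₂_eq_zero [NeZero m₂] (c : Code n m₁ m₂) (Q : ℝ≥0) (i : Fin n)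
    (f : Fin m₁ → ℝ) :
    ∫ ω, f ω.1.1 * (c.input₂ ω i - c.condMean₂ ω.1.1 i) ∂outcomeLaw n m₁ m₂ Q = 0 := by
  have h := integral_fun_fst (μ := (uniformOn (Set.univ : Set (Fin m₁))).prod
    (uniformOn (Set.univ : Set (Fin m₂)))) (ν := (gaussianPi n Q).prod (gaussianPi n 1))
    (f := fun m => f m.1 * (c.enc₂ m.1 m.2 i - c.condMean₂ m.1 i))
  refine h.trans ?_
  rw [integral_prod_eq_zero, smul_zero]
  refine ae_of_all _ fun a => ?_
  simp only
  rw [integral_const_mul, integral_sub .of_finite .of_finite]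
  simp [condMean₂]

lemma memLp_message (Q : ℝ≥0) (f : Fin m₁ × Fin m₂ → ℝ) :
    MemLp (fun ω => f ω.1) 2 (outcomeLaw n m₁ m₂ Q) := by
  have h : MemLp f 2 ((uniformOn (Set.univ : Set (Fin m₁))).prod
      (uniformOn (Set.univ : Set (Fin m₂)))) :=
    (memLp_two_iff_integrable_sq (measurable_of_countable f).aestronglyMeasurable).2 .of_finite
  exact h.comp_measurePreserving measurePreserving_fst

lemma memLp_input₁ (c : Code n m₁ m₂) {P₁ P₂ Q : ℝ≥0} (hc : c.SatisfiesPower P₁ P₂ Q)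
    (i : Fin n) : MemLp (fun ω => c.input₁ ω i) 2 (outcomeLaw n m₁ m₂ Q) := by
  have hm : Measurable fun ω => c.input₁ ω i := by
    have := c.measurable_input₁
    fun_prop
  rw [memLp_two_iff_integrable_sq hm.aestronglyMeasurable,
    ← lintegral_ofReal_ne_top_iff_integrable (by fun_prop) (ae_of_all _ fun _ => sq_nonneg _)]
  refine ((Finset.single_le_sum (f := fun i => ∫⁻ ω, ENNReal.ofReal (c.input₁ ω i ^ 2)
    ∂(outcomeLaw n m₁ m₂ Q)) (fun _ _ => zero_le) (Finset.mem_univ i)).trans hc.1).trans_lt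
    ?_ |>.ne
  exact ENNReal.mul_lt_top (by simp) (by simp)

variable [NeZero m₁] [NeZero m₂]

lemma outcomeLaw_map_state (Q : ℝ≥0) (i : Fin n) :
    (outcomeLaw n m₁ m₂ Q).map (fun ω => ω.2.1 i) = gaussianReal 0 Q :=
  ((measurePreserving_eval (fun _ : Fin n => gaussianReal 0 Q) i).comp
    (measurePreserving_fst.comp measurePreserving_snd)).map_eq

lemma outcomeLaw_map_noise (Q : ℝ≥0) (i : Fin n) :
    (outcomeLaw n m₁ m₂ Q).map (fun ω => ω.2.2 i) = gaussianReal 0 1 :=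
  ((measurePreserving_eval (fun _ : Fin n => gaussianReal 0 1) i).comp
    (measurePreserving_snd.comp measurePreserving_snd)).map_eq

lemma memLp_component (c : Code n m₁ m₂) {P₁ P₂ Q : ℝ≥0} (hc : c.SatisfiesPower P₁ P₂ Q)
    (i : Fin n) (j : Fin 6) : MemLp (c.component Q i j) 2 (outcomeLaw n m₁ m₂ Q) := by
  have hμ := memLp_message (n := n) (m₂ := m₂) Q fun m => c.condMean₁ Q m.1 i
  fin_cases j
  · exact (c.memLp_input₁ hc i).sub hμ
  · exact memLp_message Q fun m => c.enc₂ m.1 m.2 i - c.condMean₂ m.1 i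
  · exact memLp_two_of_map_eq_gaussianReal (N := fun ω : Outcome n m₁ m₂ => ω.2.1 i)
      (by fun_prop) (outcomeLaw_map_state Q i)
  · exact memLp_two_of_map_eq_gaussianReal (N := fun ω : Outcome n m₁ m₂ => ω.2.2 i)
      (by fun_prop) (outcomeLaw_map_noise Q i)
  · exact hμ
  · exact memLp_message Q fun m => c.condMean₂ m.1 i

/-- The second-order statistics of a code: the average conditional variances `A`, `B` of the
inputs given the first message, the average covariance `C` of the input of user 1 and the state,
and the average second moments `α`, `β` and correlation `ρ` of the conditional means. -/
structure HasMoments (c : Code n m₁ m₂) (Q : ℝ≥0) (A B C α β ρ : ℝ) : Prop where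
  -- The moments enter as a quadratic form in `e`, so each use only names coefficients; `f` leaves
  -- the form of the linear combination free.
  integrable_sq : ∀ (e : Fin 6 → ℝ) (f : Fin n → Outcome n m₁ m₂ → ℝ),
    (∀ i ω, f i ω = ∑ j, e j * c.component Q i j ω) →
      ∀ i, Integrable (fun ω => f i ω ^ 2) (outcomeLaw n m₁ m₂ Q)
  sum_integral_sq : ∀ (e : Fin 6 → ℝ) (f : Fin n → Outcome n m₁ m₂ → ℝ),
    (∀ i ω, f i ω = ∑ j, e j * c.component Q i j ω) →
      ∑ i, ∫ ω, f i ω ^ 2 ∂outcomeLaw n m₁ m₂ Q = n * (e 0 ^ 2 * A + e 1 ^ 2 * B + e 2 ^ 2 * Q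
        + e 3 ^ 2 + e 4 ^ 2 * α + e 5 ^ 2 * β + 2 * e 0 * e 2 * C + 2 * e 4 * e 5 * ρ)

/-- Only the pairs `(0, 2)` and `(4, 5)` can be correlated: the noise is centred and independent of
the rest, the state and user 1's deviation are centred given the messages, and user 2's deviation is
centred given `M₁`. -/
lemma integral_component_mul_component (c : Code n m₁ m₂) {P₁ P₂ Q : ℝ≥0}
    (hc : c.SatisfiesPower P₁ P₂ Q) (i : Fin n) (e : Fin 6 → ℝ) :
    ∑ j, ∑ k, e j * e k * ∫ ω, c.component Q i j ω * c.component Q i k ω ∂outcomeLaw n m₁ m₂ Q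
      = e 0 ^ 2 * (∫ ω, c.component Q i 0 ω ^ 2 ∂outcomeLaw n m₁ m₂ Q)
        + e 1 ^ 2 * (∫ ω, c.component Q i 1 ω ^ 2 ∂outcomeLaw n m₁ m₂ Q)
        + e 2 ^ 2 * Q + e 3 ^ 2
        + e 4 ^ 2 * (∫ ω, c.component Q i 4 ω ^ 2 ∂outcomeLaw n m₁ m₂ Q)
        + e 5 ^ 2 * (∫ ω, c.component Q i 5 ω ^ 2 ∂outcomeLaw n m₁ m₂ Q)
        + 2 * e 0 * e 2 * (∫ ω, c.component Q i 0 ω * c.component Q i 2 ω ∂outcomeLaw n m₁ m₂ Q)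
        + 2 * e 4 * e 5 *
          (∫ ω, c.component Q i 4 ω * c.component Q i 5 ω ∂outcomeLaw n m₁ m₂ Q) := by
  set G : Fin 6 → Fin 6 → ℝ := fun j k =>
    ∫ ω, c.component Q i j ω * c.component Q i k ω ∂outcomeLaw n m₁ m₂ Q with hG
  have hsymm : ∀ j k, G j k = G k j := fun j k => by simp only [hG, mul_comm]
  have hint := (c.memLp_input₁ hc i).integrable one_le_two
  have h10 : G 1 0 = 0 := c.integral_mul_deviation₁_eq_zero Q i hint
    fun m => c.enc₂ m.1 m.2 i - c.condMean₂ m.1 i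
  have h40 : G 4 0 = 0 := c.integral_mul_deviation₁_eq_zero Q i hint fun m => c.condMean₁ Q m.1 i
  have h50 : G 5 0 = 0 := c.integral_mul_deviation₁_eq_zero Q i hint fun m => c.condMean₂ m.1 i
  have h41 : G 4 1 = 0 := c.integral_mul_deviation₂_eq_zero Q i fun a => c.condMean₁ Q a i
  have h51 : G 5 1 = 0 := c.integral_mul_deviation₂_eq_zero Q i fun a => c.condMean₂ a i
  have h12 : G 1 2 = 0 := integral_mul_state_eq_zero Q i
    fun m => c.enc₂ m.1 m.2 i - c.condMean₂ m.1 i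
  have h42 : G 4 2 = 0 := integral_mul_state_eq_zero Q i fun m => c.condMean₁ Q m.1 i
  have h52 : G 5 2 = 0 := integral_mul_state_eq_zero Q i fun m => c.condMean₂ m.1 i
  have h03 : G 0 3 = 0 := integral_mul_noise_eq_zero Q i
    fun m s => c.enc₁ m.1 s i - c.condMean₁ Q m.1 i
  have h13 : G 1 3 = 0 := integral_mul_noise_eq_zero Q i
    fun m _ => c.enc₂ m.1 m.2 i - c.condMean₂ m.1 i
  have h23 : G 2 3 = 0 := integral_mul_noise_eq_zero Q i fun _ s => s i
  have h43 : G 4 3 = 0 := integral_mul_noise_eq_zero Q i fun m _ => c.condMean₁ Q m.1 i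
  have h53 : G 5 3 = 0 := integral_mul_noise_eq_zero Q i fun m _ => c.condMean₂ m.1 i
  have h22 : G 2 2 = Q := by
    simp only [hG, ← sq]
    exact integral_sq_of_map_eq_gaussianReal (N := fun ω : Outcome n m₁ m₂ => ω.2.1 i)
      (by fun_prop) (outcomeLaw_map_state Q i)
  have h33 : G 3 3 = 1 := by
    simp only [hG, ← sq]
    exact integral_sq_of_map_eq_gaussianReal (N := fun ω : Outcome n m₁ m₂ => ω.2.2 i)
      (by fun_prop) (outcomeLaw_map_noise Q i)
  have hsq : ∀ j, ∫ ω, c.component Q i j ω ^ 2 ∂outcomeLaw n m₁ m₂ Q = G j j := fun j => by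
    simp only [hG, sq]
  change ∑ j, ∑ k, e j * e k * G j k = _
  rw [hsq, hsq, hsq, hsq]
  change _ = e 0 ^ 2 * G 0 0 + e 1 ^ 2 * G 1 1 + e 2 ^ 2 * Q + e 3 ^ 2 + e 4 ^ 2 * G 4 4
    + e 5 ^ 2 * G 5 5 + 2 * e 0 * e 2 * G 0 2 + 2 * e 4 * e 5 * G 4 5
  simp only [Fin.sum_univ_six]
  rw [hsymm 0 1, hsymm 0 4, hsymm 0 5, hsymm 1 4, hsymm 1 5, hsymm 2 1, hsymm 2 4, hsymm 2 5,
    hsymm 3 0, hsymm 3 1, hsymm 3 2, hsymm 3 4, hsymm 3 5, hsymm 2 0, hsymm 5 4, h10, h40, h50,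
    h41, h51, h12, h42, h52, h03, h13, h23, h43, h53, h22, h33]
  ring

lemma exists_hasMoments (c : Code n m₁ m₂) (hn : n ≠ 0) {P₁ P₂ Q : ℝ≥0}
    (hc : c.SatisfiesPower P₁ P₂ Q) : ∃ A B C α β ρ, c.HasMoments Q A B C α β ρ := by
  have hn' : (n : ℝ) ≠ 0 := by exact_mod_cast hn
  refine ⟨(∑ i, ∫ ω, c.component Q i 0 ω ^ 2 ∂outcomeLaw n m₁ m₂ Q) / n,
    (∑ i, ∫ ω, c.component Q i 1 ω ^ 2 ∂outcomeLaw n m₁ m₂ Q) / n,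
    (∑ i, ∫ ω, c.component Q i 0 ω * c.component Q i 2 ω ∂outcomeLaw n m₁ m₂ Q) / n,
    (∑ i, ∫ ω, c.component Q i 4 ω ^ 2 ∂outcomeLaw n m₁ m₂ Q) / n,
    (∑ i, ∫ ω, c.component Q i 5 ω ^ 2 ∂outcomeLaw n m₁ m₂ Q) / n,
    (∑ i, ∫ ω, c.component Q i 4 ω * c.component Q i 5 ω ∂outcomeLaw n m₁ m₂ Q) / n,
    fun e f hf i => ?_, fun e f hf => ?_⟩
  · simp_rw [hf]
    exact (integral_sum_mul_sq (c.memLp_component hc i) e).1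
  · simp_rw [hf, fun i => (integral_sum_mul_sq (c.memLp_component hc i) e).2,
      fun i => c.integral_component_mul_component hc i e, Finset.sum_add_distrib,
      ← Finset.mul_sum]
    simp only [Finset.sum_const, Finset.card_univ, Fintype.card_fin, nsmul_eq_mul]
    field_simp

end Code

namespace Code

variable {n m₁ m₂ : ℕ}

namespace HasMoments

variable {c : Code n m₁ m₂} {Q : ℝ≥0} {A B C α β ρ : ℝ}

lemma quadratic_nonneg (h : c.HasMoments Q A B C α β ρ) (hn : n ≠ 0) (e : Fin 6 → ℝ) :
    0 ≤ e 0 ^ 2 * A + e 1 ^ 2 * B + e 2 ^ 2 * Q + e 3 ^ 2 + e 4 ^ 2 * α + e 5 ^ 2 * β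
      + 2 * e 0 * e 2 * C + 2 * e 4 * e 5 * ρ := by
  have hn' : (0 : ℝ) < n := by positivity
  have h1 := h.sum_integral_sq e _ fun i ω => rfl
  have h2 : 0 ≤ ∑ i, ∫ ω, (∑ j, e j * c.component Q i j ω) ^ 2 ∂outcomeLaw n m₁ m₂ Q :=
    Finset.sum_nonneg fun i _ => integral_nonneg fun ω => sq_nonneg _
  rw [h1] at h2
  exact nonneg_of_mul_nonneg_right h2 hn'

lemma A_nonneg (h : c.HasMoments Q A B C α β ρ) (hn : n ≠ 0) : 0 ≤ A := by
  simpa using h.quadratic_nonneg hn ![1, 0, 0, 0, 0, 0]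

lemma B_nonneg (h : c.HasMoments Q A B C α β ρ) (hn : n ≠ 0) : 0 ≤ B := by
  simpa using h.quadratic_nonneg hn ![0, 1, 0, 0, 0, 0]

lemma α_nonneg (h : c.HasMoments Q A B C α β ρ) (hn : n ≠ 0) : 0 ≤ α := by
  simpa using h.quadratic_nonneg hn ![0, 0, 0, 0, 1, 0]

lemma β_nonneg (h : c.HasMoments Q A B C α β ρ) (hn : n ≠ 0) : 0 ≤ β := by
  simpa using h.quadratic_nonneg hn ![0, 0, 0, 0, 0, 1]

lemma C_sq_le (h : c.HasMoments Q A B C α β ρ) (hn : n ≠ 0) : C ^ 2 ≤ A * Q := by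
  have h1 : ∀ t : ℝ, 0 ≤ A * (t * t) + 2 * C * t + Q := fun t => by
    have := h.quadratic_nonneg hn ![t, 0, 1, 0, 0, 0]
    simp at this
    linarith
  have h2 := discrim_le_zero h1
  rw [discrim] at h2
  linarith

lemma ρ_le (h : c.HasMoments Q A B C α β ρ) (hn : n ≠ 0) : ρ ≤ √α * √β := by
  have h1 : ∀ t : ℝ, 0 ≤ α * (t * t) + 2 * ρ * t + β := fun t => by
    have := h.quadratic_nonneg hn ![0, 0, 0, 0, t, 1]
    simp at this
    linarith
  have h2 := discrim_le_zero h1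
  rw [discrim] at h2
  rw [← Real.sqrt_mul (h.α_nonneg hn)]
  exact Real.le_sqrt_of_sq_le (by linarith)

end HasMoments

lemma sum_integral_input₁_sq_le (c : Code n m₁ m₂) {P₁ P₂ Q : ℝ≥0}
    (hc : c.SatisfiesPower P₁ P₂ Q) :
    ∑ i, ∫ ω, c.input₁ ω i ^ 2 ∂outcomeLaw n m₁ m₂ Q ≤ n * P₁ := by
  have h := hc.1
  have h1 : ∀ i, ∫⁻ ω, ENNReal.ofReal (c.input₁ ω i ^ 2) ∂outcomeLaw n m₁ m₂ Q
      = ENNReal.ofReal (∫ ω, c.input₁ ω i ^ 2 ∂outcomeLaw n m₁ m₂ Q) := fun i =>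
    (ofReal_integral_eq_lintegral_ofReal (c.memLp_input₁ hc i).integrable_sq
      (ae_of_all _ fun _ => sq_nonneg _)).symm
  simp_rw [h1] at h
  rw [← ENNReal.ofReal_sum_of_nonneg fun i _ => integral_nonneg fun _ => sq_nonneg _] at h
  have h2 : (n * (P₁ : ℝ≥0∞)) = ENNReal.ofReal (n * P₁) := by
    rw [ENNReal.ofReal_mul (by positivity), ENNReal.ofReal_natCast, ENNReal.ofReal_coe_nnreal]
  rw [h2] at h
  exact (ENNReal.ofReal_le_ofReal_iff (by positivity)).1 h

lemma sum_integral_input₂_sq_le (c : Code n m₁ m₂) {P₁ P₂ Q : ℝ≥0}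
    (hc : c.SatisfiesPower P₁ P₂ Q) :
    ∑ i, ∫ ω, c.input₂ ω i ^ 2 ∂outcomeLaw n m₁ m₂ Q ≤ n * P₂ := by
  have h := hc.2
  have h1 : ∀ i, ∫⁻ ω, ENNReal.ofReal (c.input₂ ω i ^ 2) ∂outcomeLaw n m₁ m₂ Q
      = ENNReal.ofReal (∫ ω, c.input₂ ω i ^ 2 ∂outcomeLaw n m₁ m₂ Q) := fun i =>
    (ofReal_integral_eq_lintegral_ofReal
      (memLp_message Q fun m => c.enc₂ m.1 m.2 i).integrable_sq
      (ae_of_all _ fun _ => sq_nonneg _)).symm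
  simp_rw [h1] at h
  rw [← ENNReal.ofReal_sum_of_nonneg fun i _ => integral_nonneg fun _ => sq_nonneg _] at h
  have h2 : (n * (P₂ : ℝ≥0∞)) = ENNReal.ofReal (n * P₂) := by
    rw [ENNReal.ofReal_mul (by positivity), ENNReal.ofReal_natCast, ENNReal.ofReal_coe_nnreal]
  rw [h2] at h
  exact (ENNReal.ofReal_le_ofReal_iff (by positivity)).1 h

lemma HasMoments.power₁ {c : Code n m₁ m₂} {P₁ P₂ Q : ℝ≥0} {A B C α β ρ : ℝ}
    (h : c.HasMoments Q A B C α β ρ) (hn : n ≠ 0) (hc : c.SatisfiesPower P₁ P₂ Q) :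
    A + α ≤ P₁ := by
  have h1 := h.sum_integral_sq ![1, 0, 0, 0, 1, 0] (fun i ω => c.input₁ ω i) fun i ω => by
    simp [Fin.sum_univ_six, component]
  have h2 := c.sum_integral_input₁_sq_le hc
  rw [h1] at h2
  have := le_of_mul_le_mul_left h2 (by positivity)
  simpa using this

lemma HasMoments.power₂ {c : Code n m₁ m₂} {P₁ P₂ Q : ℝ≥0} {A B C α β ρ : ℝ}
    (h : c.HasMoments Q A B C α β ρ) (hn : n ≠ 0) (hc : c.SatisfiesPower P₁ P₂ Q) :
    B + β ≤ P₂ := by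
  have h1 := h.sum_integral_sq ![0, 1, 0, 0, 0, 1] (fun i ω => c.input₂ ω i) fun i ω => by
    simp [Fin.sum_univ_six, component]
  have h2 := c.sum_integral_input₂_sq_le hc
  rw [h1] at h2
  have := le_of_mul_le_mul_left h2 (by positivity)
  simpa using this

end Code

/-! ### Reference laws and rate bounds for a single code -/

lemma integral_logDensity {n : ℕ} {Ω : Type*} [MeasurableSpace Ω] {P : Measure Ω}
    [IsProbabilityMeasure P] (v : ℝ≥0) {f : Fin n → Ω → ℝ}
    (hf : ∀ i, Integrable (fun ω => f i ω ^ 2) P) :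
    Integrable (fun ω => logDensity v fun i => f i ω) P ∧
    ∫ ω, logDensity v (fun i => f i ω) ∂P = n * (-(Real.log (2 * Real.pi) / 2) - Real.log v / 2)
      - (∑ i, ∫ ω, f i ω ^ 2 ∂P) / (2 * v) := by
  have hi : ∀ i, Integrable (fun ω => -(Real.log (2 * Real.pi) / 2) - Real.log v / 2
      - f i ω ^ 2 / (2 * v)) P := fun i => (integrable_const _).sub ((hf i).div_const _)
  refine ⟨integrable_finsetSum _ fun i _ => hi i, ?_⟩
  simp only [logDensity]
  rw [integral_finsetSum _ fun i _ => hi i]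
  simp_rw [fun i => integral_sub (integrable_const (μ := P)
    (-(Real.log (2 * Real.pi) / 2) - Real.log v / 2)) ((hf i).div_const (2 * (v : ℝ))),
    integral_div]
  rw [Finset.sum_sub_distrib, Finset.sum_div]
  simp [mul_sub]

namespace Code

variable {n m₁ m₂ : ℕ} {c : Code n m₁ m₂} {Q : ℝ≥0} {A B C α β ρ : ℝ}

/-- The channel output as a function of state and noise, for given messages. -/
lemma output_eq (c : Code n m₁ m₂) (a : Fin m₁) (b : Fin m₂) (s z : Fin n → ℝ) :
    c.output ((a, b), (s, z)) = c.enc₁ a s + c.enc₂ a b + s + z := rfl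

lemma HasMoments.div_le (h : c.HasMoments Q A B C α β ρ) (hn : n ≠ 0) : C ^ 2 / Q ≤ A :=
  div_le_of_le_mul₀ (by positivity) (h.A_nonneg hn) (h.C_sq_le hn)

/-- The cross term `2k√Q` is `2C`, and `k² = C²/Q` cancels against `w²`. For `Q = 0` Cauchy–Schwarz
forces `C = 0`, so division by zero does no harm. -/
lemma HasMoments.effNoise_eq (h : c.HasMoments Q A B C α β ρ) (hn : n ≠ 0) :
    effNoise Q (C / √(Q : ℝ)) √(A - C ^ 2 / Q) = A + 2 * C + Q + 1 := by
  rw [effNoise, Real.sq_sqrt (sub_nonneg.2 (h.div_le hn))]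
  by_cases hQ : Q = 0
  · have hC := h.C_sq_le hn
    simp only [hQ, NNReal.coe_zero, mul_zero] at hC
    have hC0 : C = 0 := by nlinarith [sq_nonneg C]
    simp [hQ, hC0]
  · have hQ' : (0 : ℝ) < Q := by positivity
    have hs := Real.sqrt_pos.2 hQ'
    have h1 : C / √(Q : ℝ) * √(Q : ℝ) = C := by field_simp
    have h2 : √(Q : ℝ) ^ 2 = Q := Real.sq_sqrt hQ'.le
    rw [add_sq, mul_assoc, h1, div_pow, h2]
    ring

variable [NeZero m₁] [NeZero m₂]

/-- The bound on the rate of the second message when the decoder also knows the state and the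
first message. -/
lemma HasMoments.log_card₂_le (h : c.HasMoments Q A B C α β ρ) (hn : n ≠ 0) :
    (1 - (c.errorProb Q).toReal) * Real.log m₂ - Real.log 2 ≤ n * (Real.log (1 + B) / 2) := by
  have hB := h.B_nonneg hn
  set v : ℝ≥0 := Real.toNNReal (1 + B) with hv
  have hvB : (v : ℝ) = 1 + B := Real.coe_toNNReal _ (by positivity)
  have hv0 : v ≠ 0 := toNNReal_ne_zero_of_pos (by positivity)
  have hY := c.measurable_output
  have hX := c.measurable_input₁
  have hm : Measurable fun m : Fin m₁ => c.condMean₂ m := measurable_of_countable _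
  -- The reference keeps the laws of messages and state, and makes `Y` Gaussian of variance `1 + B`
  -- around `X₁ + S + E[X₂ | M₁]`, which does not involve the second message.
  let L : Outcome n m₁ m₂ → ℝ := fun ω =>
    logDensity v (c.output ω - (c.input₁ ω + ω.2.1 + c.condMean₂ ω.1.1)) - logDensity 1 ω.2.2
  have hLm : Measurable L := by fun_prop
  have e1 : ∀ i ω, (c.output ω - (c.input₁ ω + ω.2.1 + c.condMean₂ ω.1.1)) i
      = ∑ j, (![0, 1, 0, 1, 0, 0] : Fin 6 → ℝ) j * c.component Q i j ω := fun i ω => by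
    simp [Fin.sum_univ_six, component, output]; ring
  have e2 : ∀ i (ω : Outcome n m₁ m₂), ω.2.2 i
      = ∑ j, (![0, 0, 0, 1, 0, 0] : Fin 6 → ℝ) j * c.component Q i j ω := fun i ω => by
    simp [Fin.sum_univ_six, component]
  have i1 := integral_logDensity v (h.integrable_sq _ _ e1)
  have i2 := integral_logDensity 1 (h.integrable_sq _ _ e2)
  rw [h.sum_integral_sq _ _ e1] at i1
  rw [h.sum_integral_sq _ _ e2] at i2
  have hr : ∀ a, Measurable fun p : (Fin n → ℝ) × (Fin n → ℝ) =>
      c.enc₁ a p.1 + p.1 + c.condMean₂ a + p.2 := fun a => by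
    have := c.measurable_enc₁ a
    fun_prop
  have hprob : ∀ a, IsProbabilityMeasure (((gaussianPi n Q).prod (gaussianPi n v)).map
      fun p => c.enc₁ a p.1 + p.1 + c.condMean₂ a + p.2) := fun a =>
    Measure.isProbabilityMeasure_map (hr a).aemeasurable
  have hF := c.one_sub_errorProb_mul_log_card₂_le Q hLm (i1.1.sub i2.1)
    (fun a => ((gaussianPi n Q).prod (gaussianPi n v)).map
      fun p => c.enc₁ a p.1 + p.1 + c.condMean₂ a + p.2) ?_
  · refine hF.trans (le_of_eq ?_)
    have : ∫ ω, L ω ∂outcomeLaw n m₁ m₂ Q = _ := (integral_sub i1.1 i2.1)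
    rw [this, i1.2, i2.2, hvB]
    simp
    field_simp
    ring
  · intro a b f hf
    have hfr : Measurable fun p : (Fin n → ℝ) × (Fin n → ℝ) =>
        f (c.enc₁ a p.1 + p.1 + c.condMean₂ a + p.2) := hf.comp (hr a)
    rw [lintegral_map hf (hr a), lintegral_prod _ hfr.aemeasurable]
    refine lintegral_congr fun s => ?_
    simp only [L, output_eq, input₁]
    exact lintegral_exp_output hv0 (c.enc₁ a s + c.enc₂ a b + s)
      (c.enc₁ a s + s + c.condMean₂ a) hf

/-- A Gaussian reference law for output and state whose divergence from the true law is bounded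
by the second-order statistics of the code. -/
lemma HasMoments.exists_reference (h : c.HasMoments Q A B C α β ρ) (hn : n ≠ 0) {v : ℝ≥0}
    (hv : v ≠ 0) (μ : Fin m₁ → Fin n → ℝ) (e : Fin 6 → ℝ)
    (he : ∀ i ω, (c.output ω - μ ω.1.1) i = ∑ j, e j * c.component Q i j ω)
    (hev : e 0 ^ 2 * A + e 1 ^ 2 * B + e 2 ^ 2 * Q + e 3 ^ 2 + e 4 ^ 2 * α + e 5 ^ 2 * β
      + 2 * e 0 * e 2 * C + 2 * e 4 * e 5 * ρ ≤ v) :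
    ∃ L : Outcome n m₁ m₂ → ℝ, Measurable L ∧ Integrable L (outcomeLaw n m₁ m₂ Q) ∧
      (∀ a b, ∀ f : (Fin n → ℝ) → ℝ≥0∞, Measurable f →
        ∫⁻ s, ∫⁻ z, ENNReal.ofReal (Real.exp (L ((a, b), (s, z)))) *
          f (c.output ((a, b), (s, z))) ∂gaussianPi n 1 ∂gaussianPi n Q
          = ∫⁻ y, f y ∂(gaussianPi n v).map fun y => μ a + y) ∧
      -∫ ω, L ω ∂outcomeLaw n m₁ m₂ Q ≤ n * (Real.log (1 + √(A - C ^ 2 / Q) ^ 2) / 2 +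
        Real.log (v / effNoise Q (C / √(Q : ℝ)) √(A - C ^ 2 / Q)) / 2) := by
  have hY := c.measurable_output
  have hX₂ := c.measurable_input₂
  have hm : Measurable fun m : Fin m₁ => c.condMean₁ Q m := measurable_of_countable _
  have hμ : Measurable μ := measurable_of_countable _
  have hn0 : (0 : ℝ) < n := by positivity
  have hv' : (0 : ℝ) < v := by positivity
  have hT := h.effNoise_eq hn
  have hT1 := one_le_effNoise Q (C / √(Q : ℝ)) √(A - C ^ 2 / Q)
  have hw := Real.sq_sqrt (sub_nonneg.2 (h.div_le hn))
  set T := effNoise Q (C / √(Q : ℝ)) √(A - C ^ 2 / Q) with hTdef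
  rw [hw]
  have e2 : ∀ i (ω : Outcome n m₁ m₂), ω.2.2 i
      = ∑ j, (![0, 0, 0, 1, 0, 0] : Fin 6 → ℝ) j * c.component Q i j ω := fun i ω => by
    simp [Fin.sum_univ_six, component]
  have i1 := integral_logDensity v (h.integrable_sq _ _ he)
  have i2 := integral_logDensity 1 (h.integrable_sq _ _ e2)
  rw [h.sum_integral_sq _ _ he] at i1
  rw [h.sum_integral_sq _ _ e2] at i2
  set E := e 0 ^ 2 * A + e 1 ^ 2 * B + e 2 ^ 2 * Q + e 3 ^ 2 + e 4 ^ 2 * α + e 5 ^ 2 * β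
      + 2 * e 0 * e 2 * C + 2 * e 4 * e 5 * ρ with hE
  have hEv : n * E / (2 * v) ≤ n / 2 := by
    rw [div_le_div_iff₀ (by positivity) two_pos]
    nlinarith
  have hmap : ∀ a, ∀ f : (Fin n → ℝ) → ℝ≥0∞, Measurable f →
      ∫⁻ y, f (μ a + y) ∂gaussianPi n v
        = ∫⁻ y, f y ∂(gaussianPi n v).map fun y => μ a + y := fun a f hf =>
    (lintegral_map hf (by fun_prop)).symm
  -- A degenerate state has no density. Then `T = 1 + w²`, the two logarithms involving the state
  -- cancel, and replacing the output alone suffices.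
  by_cases hQ : Q = 0
  · refine ⟨fun ω => logDensity v (c.output ω - μ ω.1.1) - logDensity 1 ω.2.2, by fun_prop,
      i1.1.sub i2.1, fun a b f hf => ?_, ?_⟩
    · rw [← hmap a f hf]
      have hin : ∀ s, ∫⁻ z, ENNReal.ofReal (Real.exp (logDensity v
          (c.output ((a, b), (s, z)) - μ a) - logDensity 1 z)) * f (c.output ((a, b), (s, z)))
          ∂gaussianPi n 1 = ∫⁻ y, f (μ a + y) ∂gaussianPi n v := fun s => by
        simp only [output_eq]
        exact lintegral_exp_output hv (c.enc₁ a s + c.enc₂ a b + s) (μ a) hf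
      simp only [hin, lintegral_const, measure_univ, mul_one]
    · have : ∫ ω, (logDensity v (c.output ω - μ ω.1.1) - logDensity 1 ω.2.2)
          ∂outcomeLaw n m₁ m₂ Q = _ := (integral_sub i1.1 i2.1)
      rw [this, i1.2, i2.2]
      have hT' : T = 1 + (A - C ^ 2 / Q) := by
        rw [hTdef, effNoise, hw, hQ]
        simp
        ring
      rw [Real.log_div hv'.ne' (by positivity), hT']
      simp
      linarith
  · have hQ' : (0 : ℝ) < Q := by positivity
    set w2 := A - C ^ 2 / Q with hw2
    have hw0 : 0 ≤ w2 := sub_nonneg.2 (h.div_le hn)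
    have hT0 : 0 < T := by linarith
    -- Below, `g` is the coefficient and `t` the error of the block-averaged linear least-squares
    -- estimate of `S` from `X₁ - E[X₁ | M₁] + S + Z`, which has variance `T` and covariance `C + Q`
    -- with `S`. The error is `Q - (C + Q)²/T`, and `QT - (C + Q)² = Q(A + 1) - C² = Q(1 + w²)`.
    set t : ℝ≥0 := Real.toNNReal (Q * (1 + w2) / T) with ht
    have htr : (t : ℝ) = Q * (1 + w2) / T := Real.coe_toNNReal _ (by positivity)
    have ht0 : t ≠ 0 := toNNReal_ne_zero_of_pos (by positivity)
    set g := (C + Q) / T with hg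
    have e3 : ∀ i (ω : Outcome n m₁ m₂), ω.2.1 i
        = ∑ j, (![0, 0, 1, 0, 0, 0] : Fin 6 → ℝ) j * c.component Q i j ω := fun i ω => by
      simp [Fin.sum_univ_six, component]
    have e4 : ∀ i (ω : Outcome n m₁ m₂),
        (ω.2.1 - g • (c.output ω - (c.condMean₁ Q ω.1.1 + c.input₂ ω))) i
        = ∑ j, (![-g, 0, 1 - g, -g, 0, 0] : Fin 6 → ℝ) j * c.component Q i j ω := fun i ω => by
      simp [Fin.sum_univ_six, component, output]; ring
    have i3 := integral_logDensity Q (h.integrable_sq _ _ e3)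
    have i4 := integral_logDensity t (h.integrable_sq _ _ e4)
    rw [h.sum_integral_sq _ _ e3] at i3
    rw [h.sum_integral_sq _ _ e4] at i4
    refine ⟨fun ω => logDensity v (c.output ω - μ ω.1.1)
      + logDensity t (ω.2.1 - g • (c.output ω - (c.condMean₁ Q ω.1.1 + c.input₂ ω)))
      - logDensity Q ω.2.1 - logDensity 1 ω.2.2, by fun_prop,
      ((i1.1.add i4.1).sub i3.1).sub i2.1, fun a b f hf => ?_, ?_⟩
    · rw [← hmap a f hf]
      simp only [output_eq, input₂]
      exact lintegral_exp_state_output hv ht0 hQ g (fun s => c.enc₁ a s + c.enc₂ a b + s) (μ a)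
        (c.condMean₁ Q a + c.enc₂ a b) hf
    · have : ∫ ω, (logDensity v (c.output ω - μ ω.1.1)
          + logDensity t (ω.2.1 - g • (c.output ω - (c.condMean₁ Q ω.1.1 + c.input₂ ω)))
          - logDensity Q ω.2.1 - logDensity 1 ω.2.2) ∂outcomeLaw n m₁ m₂ Q = _ :=
        (integral_sub ((i1.1.add i4.1).sub i3.1) i2.1).trans (congrArg (· - _)
          ((integral_sub (i1.1.add i4.1) i3.1).trans (congrArg (· - _)
            (integral_add i1.1 i4.1))))
      rw [this, i1.2, i2.2, i3.2, i4.2]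
      have ht2 : g ^ 2 * A + (1 - g) ^ 2 * Q + g ^ 2 - 2 * g * (1 - g) * C = t := by
        rw [htr, eq_div_iff hT0.ne']
        have hgT : g * T = C + Q := by rw [hg]; field_simp
        have hQw : Q * (1 + w2) = Q * T - (C + Q) ^ 2 := by
          rw [hT, hw2]; field_simp; ring
        rw [hQw]
        have hA : A = T - 2 * C - Q - 1 := by linarith
        rw [hA]
        linear_combination (g * T - (C + Q)) * hgT
      have ht3 : g ^ 2 * A + (1 - g) ^ 2 * Q + g ^ 2 + -(2 * g * (1 - g) * C) = t := by
        rw [← ht2]; ring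
      have hlt : Real.log t = Real.log Q + Real.log (1 + w2) - Real.log T := by
        rw [htr, Real.log_div (by positivity) (by positivity),
          Real.log_mul (by positivity) (by positivity)]
      rw [Real.log_div hv'.ne' hT0.ne']
      simp
      rw [ht3, hlt]
      -- The quadratic terms contribute at most `n/2` from the output and `n/2` from the estimation
      -- error, against `n/2` each from `S` and `Z`; only logarithms remain.
      have d1 : n * (t : ℝ) / (2 * t) = n / 2 := by field_simp
      have d2 : n * (Q : ℝ) / (2 * Q) = n / 2 := by field_simp
      rw [d1, d2]
      linarith

end Code

/-! ### From codes to the Gaussian region, and the limit of large blocklength -/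

namespace Code

variable {n m₁ m₂ : ℕ} [NeZero m₁] [NeZero m₂]

/-- Charging Fano's `log 2` to the second rate suffices, as that rate occurs once in each of the
three bounds. It may become negative, which `gaussianRegion` permits. -/
theorem mem_gaussianRegion (c : Code n m₁ m₂) (hn : n ≠ 0) {P₁ P₂ Q : ℝ≥0}
    (hc : c.SatisfiesPower P₁ P₂ Q) :
    ((1 - (c.errorProb Q).toReal) * Real.log m₁ / n,
      ((1 - (c.errorProb Q).toReal) * Real.log m₂ - Real.log 2) / n)
        ∈ gaussianRegion P₁ P₂ Q := by
  obtain ⟨A, B, C, α, β, ρ, h⟩ := c.exists_hasMoments hn hc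
  have hn0 : (0 : ℝ) < n := by positivity
  have hw := Real.sq_sqrt (sub_nonneg.2 (h.div_le hn))
  have hT := h.effNoise_eq hn
  have hT1 := one_le_effNoise Q (C / √(Q : ℝ)) √(A - C ^ 2 / Q)
  have hα := Real.sq_sqrt (h.α_nonneg hn)
  have hβ := Real.sq_sqrt (h.β_nonneg hn)
  have hB := Real.sq_sqrt (h.B_nonneg hn)
  have hρ := h.ρ_le hn
  have hB0 := h.B_nonneg hn
  have hk : (C / √(Q : ℝ)) ^ 2 = C ^ 2 / Q := by rw [div_pow, Real.sq_sqrt (NNReal.coe_nonneg Q)]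
  refine ⟨√α, C / √(Q : ℝ), √(A - C ^ 2 / Q), √β, √B, ?_, ?_, ?_, ?_, ?_, ?_⟩
  · have := h.power₁ hn hc
    linarith
  · have := h.power₂ hn hc
    linarith
  · rintro rfl
    simp
  · rw [div_le_iff₀ hn0, hB]
    linarith [h.log_card₂_le hn]
  · rw [div_le_iff₀ hn0, hB]
    set T := effNoise Q (C / √(Q : ℝ)) √(A - C ^ 2 / Q)
    have hv : ((Real.toNNReal (T + B) : ℝ≥0) : ℝ) = T + B :=
      Real.coe_toNNReal _ (by linarith)
    -- Centring at the conditional means removes `α`, `β`, `ρ` and keeps the reference output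
    -- independent of the second message.
    obtain ⟨L, hLm, hL, hq, hle⟩ := h.exists_reference hn (v := Real.toNNReal (T + B))
      (toNNReal_ne_zero_of_pos (by linarith)) (fun a => c.condMean₁ Q a + c.condMean₂ a)
      ![1, 1, 1, 1, 0, 0]
      (fun i ω => by simp [Fin.sum_univ_six, component, output]; ring)
      (by rw [hv, hT]; simp; linarith)
    have hprob : ∀ a, IsProbabilityMeasure ((gaussianPi n (Real.toNNReal (T + B))).map
        fun y => c.condMean₁ Q a + c.condMean₂ a + y) := fun a =>
      Measure.isProbabilityMeasure_map (by fun_prop)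
    have hF := c.one_sub_errorProb_mul_log_card₂_le Q hLm hL _ hq
    rw [hv] at hle
    linarith
  · rw [← add_div, div_le_iff₀ hn0, hB]
    set T := effNoise Q (C / √(Q : ℝ)) √(A - C ^ 2 / Q)
    have hpos : 0 < T + B + (√α + √β) ^ 2 := by positivity
    have hv : ((Real.toNNReal (T + B + (√α + √β) ^ 2) : ℝ≥0) : ℝ) = T + B + (√α + √β) ^ 2 :=
      Real.coe_toNNReal _ hpos.le
    -- Centre `0` makes the reference output independent of both messages; `α + β + 2ρ ≤ (√α + √β)²`
    -- bounds the output power.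
    obtain ⟨L, hLm, hL, hq, hle⟩ := h.exists_reference hn
      (v := Real.toNNReal (T + B + (√α + √β) ^ 2))
      (toNNReal_ne_zero_of_pos hpos) (fun _ => 0) ![1, 1, 1, 1, 1, 1]
      (fun i ω => by simp [Fin.sum_univ_six, component, output]; ring)
      (by rw [hv, hT, add_sq, hα, hβ]; simp; linarith)
    have hprob : IsProbabilityMeasure ((gaussianPi n (Real.toNNReal (T + B + (√α + √β) ^ 2))).map
        fun y => 0 + y) :=
      Measure.isProbabilityMeasure_map (by fun_prop)
    have hF := c.one_sub_errorProb_mul_log_card_le Q hLm hL _ hq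
    rw [hv] at hle
    linarith

end Code

lemma gaussianRegion_mono {P₁ P₂ Q : ℝ≥0} {R₁ R₂ R₁' R₂' : ℝ}
    (h : (R₁', R₂') ∈ gaussianRegion P₁ P₂ Q) (h₁ : R₁ ≤ R₁') (h₂ : R₂ ≤ R₂') :
    (R₁, R₂) ∈ gaussianRegion P₁ P₂ Q := by
  obtain ⟨a, k, w, b, v, hP₁, hP₂, hQ, hR₁, hR₂, hR₃⟩ := h
  exact ⟨a, k, w, b, v, hP₁, hP₂, hQ, h₂.trans hR₁, h₂.trans hR₂, (add_le_add h₁ h₂).trans hR₃⟩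

@[fun_prop]
lemma continuous_effNoise (Q : ℝ≥0) : Continuous fun p : ℝ × ℝ => effNoise Q p.1 p.2 := by
  unfold effNoise; fun_prop

/-- The power constraints confine the five parameters to a compact set and the rate bounds are
continuous in them, so the region is the projection of a closed set along a compact factor. -/
lemma isClosed_gaussianRegion (P₁ P₂ Q : ℝ≥0) : IsClosed (gaussianRegion P₁ P₂ Q) := by
  let T : (Fin 5 → ℝ) → ℝ := fun x => effNoise Q (x 1) (x 2)
  have hT : Continuous T := by
    have := (continuous_effNoise Q).comp
      (by fun_prop : Continuous fun x : Fin 5 → ℝ => (x 1, x 2))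
    exact this
  have hT0 : ∀ x, 0 < T x := fun x => zero_lt_one.trans_le (one_le_effNoise _ _ _)
  let F₁ : (Fin 5 → ℝ) → ℝ := fun x => Real.log (1 + x 4 ^ 2) / 2
  let F₂ : (Fin 5 → ℝ) → ℝ := fun x => Real.log (1 + x 2 ^ 2) / 2 +
      Real.log ((T x + x 4 ^ 2) / T x) / 2
  let F₃ : (Fin 5 → ℝ) → ℝ := fun x => Real.log (1 + x 2 ^ 2) / 2 +
      Real.log ((T x + x 4 ^ 2 + (x 0 + x 3) ^ 2) / T x) / 2
  have hw : Continuous fun x : Fin 5 → ℝ => Real.log (1 + x 2 ^ 2) :=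
    Continuous.log (by fun_prop) fun x => by positivity
  have hF₁ : Continuous F₁ :=
    (Continuous.log (by fun_prop) fun x => by positivity).div_const _
  have hF₂ : Continuous F₂ := by
    refine (hw.div_const _).add ((Continuous.log (Continuous.div (by fun_prop) hT
      fun x => (hT0 x).ne') fun x => ?_).div_const _)
    exact (div_pos (add_pos_of_pos_of_nonneg (hT0 x) (sq_nonneg _)) (hT0 x)).ne'
  have hF₃ : Continuous F₃ := by
    refine (hw.div_const _).add ((Continuous.log (Continuous.div (by fun_prop) hT
      fun x => (hT0 x).ne') fun x => ?_).div_const _)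
    exact (div_pos (add_pos_of_pos_of_nonneg (add_pos_of_pos_of_nonneg (hT0 x) (sq_nonneg _))
      (sq_nonneg _)) (hT0 x)).ne'
  let K : Set (Fin 5 → ℝ) := {x | x 0 ^ 2 + x 1 ^ 2 + x 2 ^ 2 ≤ P₁ ∧ x 3 ^ 2 + x 4 ^ 2 ≤ P₂ ∧
    (Q = 0 → x 1 = 0)}
  have hK : IsCompact K := by
    refine Metric.isCompact_of_isClosed_isBounded ?_ ?_
    · have c₁ : IsClosed {x : Fin 5 → ℝ | x 0 ^ 2 + x 1 ^ 2 + x 2 ^ 2 ≤ P₁} :=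
        isClosed_le (by fun_prop) (by fun_prop)
      have c₂ : IsClosed {x : Fin 5 → ℝ | x 3 ^ 2 + x 4 ^ 2 ≤ P₂} :=
        isClosed_le (by fun_prop) (by fun_prop)
      have c₃ : IsClosed {x : Fin 5 → ℝ | Q = 0 → x 1 = 0} := by
        by_cases hQ : Q = 0
        · simpa [hQ] using isClosed_eq (continuous_apply (1 : Fin 5)) continuous_const
        · simp [hQ]
      exact c₁.inter (c₂.inter c₃)
    · refine (Metric.isBounded_Icc (fun _ => -(1 + P₁ + P₂ : ℝ))
        (fun _ => (1 + P₁ + P₂ : ℝ))).subset ?_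
      rintro x ⟨h₁, h₂, -⟩
      have hP₁ : (0 : ℝ) ≤ P₁ := P₁.2
      have hP₂ : (0 : ℝ) ≤ P₂ := P₂.2
      have hx : ∀ i, x i ^ 2 ≤ (1 + P₁ + P₂ : ℝ) ^ 2 := by
        intro i
        fin_cases i <;> simp <;>
          nlinarith [sq_nonneg (x 0), sq_nonneg (x 1), sq_nonneg (x 2), sq_nonneg (x 3),
            sq_nonneg (x 4), mul_nonneg hP₁ hP₂, sq_nonneg (P₁ : ℝ), sq_nonneg (P₂ : ℝ)]
      exact ⟨fun i => (abs_le_of_sq_le_sq' (hx i) (by positivity)).1,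
        fun i => (abs_le_of_sq_le_sq' (hx i) (by positivity)).2⟩
  have : CompactSpace K := isCompact_iff_compactSpace.1 hK
  have himage : gaussianRegion P₁ P₂ Q = Prod.snd '' {p : K × (ℝ × ℝ) |
      p.2.2 ≤ F₁ p.1 ∧ p.2.2 ≤ F₂ p.1 ∧ p.2.1 + p.2.2 ≤ F₃ p.1} := by
    ext R
    constructor
    · rintro ⟨a, k, w, b, v, hP₁, hP₂, hQ, hR⟩
      exact ⟨(⟨![a, k, w, b, v], hP₁, hP₂, hQ⟩, R), hR, rfl⟩
    · rintro ⟨⟨⟨x, hP₁, hP₂, hQ⟩, R⟩, hR, rfl⟩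
      exact ⟨x 0, x 1, x 2, x 3, x 4, hP₁, hP₂, hQ, hR⟩
  rw [himage]
  refine isClosedMap_snd_of_compactSpace _ ?_
  have c₁ : IsClosed {p : K × (ℝ × ℝ) | p.2.2 ≤ F₁ p.1} :=
    isClosed_le (by fun_prop) (by fun_prop)
  have c₂ : IsClosed {p : K × (ℝ × ℝ) | p.2.2 ≤ F₂ p.1} :=
    isClosed_le (by fun_prop) (by fun_prop)
  have c₃ : IsClosed {p : K × (ℝ × ℝ) | p.2.1 + p.2.2 ≤ F₃ p.1} :=
    isClosed_le (by fun_prop) (by fun_prop)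
  exact c₁.inter (c₂.inter c₃)

lemma Achievable.mem_gaussianRegion {P₁ P₂ Q : ℝ≥0} {R₁ R₂ : ℝ}
    (h : Achievable P₁ P₂ Q R₁ R₂) : (R₁, R₂) ∈ gaussianRegion P₁ P₂ Q := by
  obtain ⟨h₁, h₂, c, hc, herr⟩ := h
  have hne : ∀ x : ℝ, NeZero ⌈Real.exp x⌉₊ := fun x =>
    ⟨(Nat.ceil_pos.2 (Real.exp_pos x)).ne'⟩
  have hlog : ∀ x : ℝ, x ≤ Real.log ⌈Real.exp x⌉₊ := fun x =>
    (Real.le_log_iff_exp_le (by exact_mod_cast Nat.ceil_pos.2 (Real.exp_pos x))).2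
      (Nat.le_ceil _)
  set ε : ℕ → ℝ := fun n => ((c n).errorProb Q).toReal with hε
  have hε0 : Tendsto ε atTop (𝓝 0) := (ENNReal.tendsto_toReal ENNReal.zero_ne_top).comp herr
  have hε1 : ∀ n, 0 ≤ 1 - ε n := fun n => by
    have := hne (n * R₁)
    have := hne (n * R₂)
    have : ε n ≤ 1 := ENNReal.toReal_le_of_le_ofReal zero_le_one (by
      rw [ENNReal.ofReal_one]; exact prob_le_one)
    linarith
  -- Since `log ⌈exp (n R)⌉ ≥ n R` and the region is closed downwards, the exact message counts can
  -- be replaced by the nominal rates before passing to the limit.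
  have hmem : ∀ᶠ n : ℕ in atTop, ((1 - ε n) * R₁, (1 - ε n) * R₂ - Real.log 2 / n)
      ∈ gaussianRegion P₁ P₂ Q := by
    filter_upwards [eventually_ne_atTop 0] with n hn
    have := hne (n * R₁)
    have := hne (n * R₂)
    have hn0 : (0 : ℝ) < n := by positivity
    refine gaussianRegion_mono ((c n).mem_gaussianRegion hn (hc n)) ?_ ?_
    · rw [le_div_iff₀ hn0, mul_assoc, mul_comm R₁]
      exact mul_le_mul_of_nonneg_left (hlog _) (hε1 n)
    · rw [sub_div, le_sub_iff_add_le, sub_add_cancel, le_div_iff₀ hn0, mul_assoc, mul_comm R₂]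
      exact mul_le_mul_of_nonneg_left (hlog _) (hε1 n)
  refine (isClosed_gaussianRegion P₁ P₂ Q).mem_of_tendsto ?_ hmem
  have hε2 : Tendsto (fun n => 1 - ε n) atTop (𝓝 1) := by
    simpa using hε0.const_sub 1
  refine Tendsto.prodMk_nhds ?_ ?_
  · simpa using hε2.mul_const R₁
  · simpa using (hε2.mul_const R₂).sub (tendsto_const_div_atTop_nhds_zero_nat (Real.log 2))

end DirtyMAC

theorem proposition2 (P₁ P₂ Q : ℝ≥0) :
    DirtyMAC.capacityRegionDeg P₁ P₂ Q ⊆ DirtyMAC.outerRegionDeg P₁ P₂ Q :=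
  (closure_minimal (fun _ hR => DirtyMAC.Achievable.mem_gaussianRegion hR)
    (DirtyMAC.isClosed_gaussianRegion P₁ P₂ Q)).trans
      (DirtyMAC.gaussianRegion_subset_outerRegionDeg P₁ P₂ Q)
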